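/- Let $\mathbb{K}$ be a field of characteristic zero and let $\mathbf{Ch}(\mathbb{K})$ be the category of (possibly unbounded) chain complexes of $\mathbb{K}$-vector spaces, with its usual symmetric monoidal structure (Koszul signs). A unital Lie algebra in $\mathbf{Ch}(\mathbb{K})$ is a chain complex $V$ with a chain map $[\cdot,\cdot]:V\otimes V\to V$ and a chain map $\eta:\mathbb{K}\to V$, i.e. a cycle $\mathbb{1}=\eta(1)\in V_0$, such that the bracket is graded antisymmetric, satisfies the graded Jacobi identity, and $[v,\mathbb{1}]=0$ for all $v\in V$; morphisms are chain maps preserving bracket and unit. Denote their category by $\mathbf{Alg}_{\mathsf{uLie}}$, and let $\mathbf{Alg}_{\mathsf{As}}$ be the category of associative unital algebras in $\mathbf{Ch}(\mathbb{K})$, i.e. of (not necessarily commutative, possibly zero) unital differential graded algebras. The unital universal enveloping algebra functor $\phi_!:\mathbf{Alg}_{\mathsf{uLie}}\to\mathbf{Alg}_{\mathsf{As}}$ sends $V$ to the differential graded algebra $\phi_!(V)=T^{\otimes}V/\mathcal{I}$, the quotient of the tensor algebra $T^\otimes V=\bigoplus_{m\ge 0}V^{\otimes m}$ by the two-sided differential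 graded ideal generated by the relations $$v_1\otimes v_2-(-1)^{|v_1||v_2|}\,v_2\otimes v_1=[v_1,v_2],\qquad \mathbb{1}_\otimes=\mathbb{1},$$ for all homogeneous $v_1,v_2\in V$, where $\mathbb{1}_\otimes$ is the unit of $T^\otimes V$; its differential and grading are induced from those of $V$, and a morphism $f$ is sent to the algebra map that extends $f$ multiplicatively. Call a morphism in $\mathbf{Alg}_{\mathsf{uLie}}$ or $\mathbf{Alg}_{\mathsf{As}}$ a weak equivalence if its underlying chain map is a quasi-isomorphism. Then $\phi_!$ preserves weak equivalences: if $f:V\to V'$ is a weak equivalence in $\mathbf{Alg}_{\mathsf{uLie}}$, then $\phi_!(f):\phi_!(V)\to\phi_!(V')$ is a weak equivalence in $\mathbf{Alg}_{\mathsf{As}}$. -/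

import Mathlib

open CategoryTheory

universe u v

/-- A unital Lie algebra in chain complexes of `K`-vector spaces (unbounded, homological grading):
a chain complex `X` with a degree-zero chain map `[·,·] : X ⊗ X ⟶ X` and a chain map `K ⟶ X`,
i.e. a cycle `one` of degree `0`. The equality `h : i + j = k` carried by `bracket h` only spares us
casts between `X_{(i+j)+k}` and `X_{i+(j+k)}`. Signs follow the Koszul rule. -/
structure ULieAlg (K : Type u) [Field K] where
  /-- the underlying chain complex -/
  X : ChainComplex (ModuleCat.{v} K) ℤ
  /-- the Lie bracket `X_i ⊗ X_j → X_k`, `i + j = k` -/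
  bracket : ∀ {i j k : ℤ}, i + j = k → X.X i →ₗ[K] X.X j →ₗ[K] X.X k
  /-- the unit element -/
  one : X.X 0
  /-- the unit is a cycle -/
  d_one : (X.d 0 (-1)).hom one = 0
  /-- the bracket is a chain map -/
  d_bracket : ∀ {i j k i' j' k' : ℤ} (h : i + j = k) (hi : i' + 1 = i) (hj : j' + 1 = j)
    (hk : k' + 1 = k) (a : X.X i) (b : X.X j),
    (X.d k k').hom (bracket h a b) =
      bracket (show i' + j = k' by omega) ((X.d i i').hom a) b +
        i.negOnePow • bracket (show i + j' = k' by omega) a ((X.d j j').hom b)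
  /-- graded antisymmetry -/
  antisymm : ∀ {i j k : ℤ} (h : i + j = k) (a : X.X i) (b : X.X j),
    bracket h a b = -((i * j).negOnePow • bracket (show j + i = k by omega) b a)
  /-- graded Jacobi identity -/
  jacobi : ∀ {i j k ij jk ki n : ℤ} (hij : i + j = ij) (hjk : j + k = jk) (hki : k + i = ki)
    (hn : i + jk = n) (a : X.X i) (b : X.X j) (c : X.X k),
    (i * k).negOnePow • bracket hn a (bracket hjk b c) +
      (j * i).negOnePow • bracket (show j + ki = n by omega) b (bracket hki c a) +
      (k * j).negOnePow • bracket (show k + ij = n by omega) c (bracket hij a b) = 0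
  /-- the bracket with the unit vanishes -/
  bracket_one : ∀ {i : ℤ} (a : X.X i), bracket (add_zero i) a one = 0

/-- An associative unital algebra in chain complexes of `K`-vector spaces, i.e. a (not necessarily
commutative) differential graded algebra. The zero algebra is allowed. -/
structure AsAlg (K : Type u) [Field K] where
  /-- the underlying chain complex -/
  X : ChainComplex (ModuleCat.{v} K) ℤ
  /-- the multiplication `X_i ⊗ X_j → X_k`, `i + j = k` -/
  mul : ∀ {i j k : ℤ}, i + j = k → X.X i →ₗ[K] X.X j →ₗ[K] X.X k
  /-- the unit element -/
  one : X.X 0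
  /-- the unit is a cycle -/
  d_one : (X.d 0 (-1)).hom one = 0
  /-- the multiplication is a chain map -/
  d_mul : ∀ {i j k i' j' k' : ℤ} (h : i + j = k) (hi : i' + 1 = i) (hj : j' + 1 = j)
    (hk : k' + 1 = k) (a : X.X i) (b : X.X j),
    (X.d k k').hom (mul h a b) =
      mul (show i' + j = k' by omega) ((X.d i i').hom a) b +
        i.negOnePow • mul (show i + j' = k' by omega) a ((X.d j j').hom b)
  /-- associativity -/
  mul_assoc : ∀ {i j k ij jk n : ℤ} (hij : i + j = ij) (hjk : j + k = jk) (hn : ij + k = n)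
    (a : X.X i) (b : X.X j) (c : X.X k),
    mul hn (mul hij a b) c = mul (show i + jk = n by omega) a (mul hjk b c)
  /-- left unitality -/
  one_mul : ∀ {i : ℤ} (a : X.X i), mul (zero_add i) one a = a
  /-- right unitality -/
  mul_one : ∀ {i : ℤ} (a : X.X i), mul (add_zero i) a one = a

section

variable {K : Type u} [Field K]

namespace ULieAlg

/-- Morphisms of unital Lie algebras: chain maps compatible with bracket and unit. -/
@[ext]
structure Hom (V W : ULieAlg.{u, v} K) where
  /-- the underlying chain map -/
  hom : V.X ⟶ W.X
  map_bracket : ∀ {i j k : ℤ} (h : i + j = k) (a : V.X.X i) (b : V.X.X j),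
    (hom.f k).hom (V.bracket h a b) = W.bracket h ((hom.f i).hom a) ((hom.f j).hom b)
  map_one : (hom.f 0).hom V.one = W.one

instance : Category (ULieAlg.{u, v} K) where
  Hom := Hom
  id V := ⟨𝟙 _, by intros; simp, by simp⟩
  comp f g := ⟨f.hom ≫ g.hom, by intros; simp [f.map_bracket, g.map_bracket],
    by simp [f.map_one, g.map_one]⟩
  id_comp f := Hom.ext (Category.id_comp f.hom)
  comp_id f := Hom.ext (Category.comp_id f.hom)
  assoc f g h := Hom.ext (Category.assoc f.hom g.hom h.hom)

end ULieAlg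

namespace AsAlg

/-- Morphisms of differential graded algebras: chain maps compatible with product and unit. -/
@[ext]
structure Hom (A B : AsAlg.{u, v} K) where
  /-- the underlying chain map -/
  hom : A.X ⟶ B.X
  map_mul : ∀ {i j k : ℤ} (h : i + j = k) (a : A.X.X i) (b : A.X.X j),
    (hom.f k).hom (A.mul h a b) = B.mul h ((hom.f i).hom a) ((hom.f j).hom b)
  map_one : (hom.f 0).hom A.one = B.one

instance : Category (AsAlg.{u, v} K) where
  Hom := Hom
  id V := ⟨𝟙 _, by intros; simp, by simp⟩
  comp f g := ⟨f.hom ≫ g.hom, by intros; simp [f.map_mul, g.map_mul],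
    by simp [f.map_one, g.map_one]⟩
  id_comp f := Hom.ext (Category.id_comp f.hom)
  comp_id f := Hom.ext (Category.comp_id f.hom)
  assoc f g h := Hom.ext (Category.assoc f.hom g.hom h.hom)

end AsAlg

namespace ULieAlg

open scoped DirectSum

/-- The total vector space `⨁ i, V_i` of a unital Lie algebra. -/
abbrev Tot (V : ULieAlg.{u, v} K) : Type v := ⨁ i : ℤ, (V.X.X i : Type v)

/-- The degree-`i` part of `V` as generators of the tensor algebra of `V`. -/
noncomputable def tgen (V : ULieAlg.{u, v} K) (i : ℤ) : V.X.X i →ₗ[K] TensorAlgebra K V.Tot :=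
  TensorAlgebra.ι K ∘ₗ DirectSum.lof K ℤ (fun i => (V.X.X i : Type v)) i

/-- The relations of the unital universal enveloping algebra:
`a ⊗ b - (-1)^{|a||b|} b ⊗ a = [a, b]` for homogeneous `a`, `b`, and `1_V = 1_⊗`. -/
inductive EnvRel (V : ULieAlg.{u, v} K) : TensorAlgebra K V.Tot → TensorAlgebra K V.Tot → Prop
  | comm {i j k : ℤ} (h : i + j = k) (a : V.X.X i) (b : V.X.X j) :
      EnvRel V (V.tgen i a * V.tgen j b - (i * j).negOnePow • (V.tgen j b * V.tgen i a))
        (V.tgen k (V.bracket h a b))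
  | unit : EnvRel V (V.tgen 0 V.one) 1

/-- The algebra underlying the unital universal enveloping algebra: the quotient of the tensor
algebra by the two-sided ideal generated by the relations `EnvRel`. -/
def Env (V : ULieAlg.{u, v} K) : Type (max u v) := RingQuot (EnvRel V)

noncomputable instance (V : ULieAlg.{u, v} K) : Ring V.Env :=
  inferInstanceAs (Ring (RingQuot (EnvRel V)))

noncomputable instance (V : ULieAlg.{u, v} K) : Algebra K V.Env :=
  inferInstanceAs (Algebra K (RingQuot (EnvRel V)))

/-- The quotient map from the tensor algebra to the enveloping algebra. -/
noncomputable def envMk (V : ULieAlg.{u, v} K) : TensorAlgebra K V.Tot →ₐ[K] V.Env :=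
  RingQuot.mkAlgHom K (EnvRel V)

theorem envMk_surjective (V : ULieAlg.{u, v} K) : Function.Surjective V.envMk :=
  RingQuot.mkAlgHom_surjective K (EnvRel V)

/-- The canonical map from `V_i` to the unital universal enveloping algebra. -/
noncomputable def gen (V : ULieAlg.{u, v} K) (i : ℤ) : V.X.X i →ₗ[K] V.Env :=
  V.envMk.toLinearMap ∘ₗ V.tgen i

theorem gen_comm (V : ULieAlg.{u, v} K) {i j k : ℤ} (h : i + j = k) (a : V.X.X i) (b : V.X.X j) :
    V.gen i a * V.gen j b - (i * j).negOnePow • (V.gen j b * V.gen i a) =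
      V.gen k (V.bracket h a b) := by
  have : V.envMk _ = V.envMk _ := RingQuot.mkAlgHom_rel K (EnvRel.comm h a b)
  simpa [gen, Units.smul_def] using this

theorem gen_one (V : ULieAlg.{u, v} K) : V.gen 0 V.one = 1 := by
  have : V.envMk _ = V.envMk _ := RingQuot.mkAlgHom_rel K (EnvRel.unit (V := V))
  simpa [gen] using this

/-- The algebra map out of the enveloping algebra given by its values on homogeneous generators. -/
noncomputable def envLift (V : ULieAlg.{u, v} K) {B : Type*} [Ring B] [Algebra K B]
    (g : ∀ i, V.X.X i →ₗ[K] B)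
    (hg : ∀ {i j k : ℤ} (h : i + j = k) (a : V.X.X i) (b : V.X.X j),
      g i a * g j b - (i * j).negOnePow • (g j b * g i a) = g k (V.bracket h a b))
    (h1 : g 0 V.one = 1) : V.Env →ₐ[K] B :=
  RingQuot.liftAlgHom K ⟨TensorAlgebra.lift K (DirectSum.toModule K ℤ B g), by
    intro x y hxy
    cases hxy with
    | comm h a b => simpa [tgen, Units.smul_def] using hg h a b
    | unit => simpa [tgen] using h1⟩

@[simp] theorem envLift_gen (V : ULieAlg.{u, v} K) {B : Type*} [Ring B] [Algebra K B]
    (g : ∀ i, V.X.X i →ₗ[K] B) (hg) (h1) (i : ℤ) (a : V.X.X i) :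
    V.envLift g hg h1 (V.gen i a) = g i a := by
  refine (RingQuot.liftAlgHom_mkAlgHom_apply K _ _ _).trans ?_
  simp [tgen]

theorem env_induction (V : ULieAlg.{u, v} K) {p : V.Env → Prop} (one : p 1)
    (gen_mul : ∀ i (a : V.X.X i) x, p x → p (V.gen i a * x))
    (add : ∀ x y, p x → p y → p (x + y)) (smul : ∀ (c : K) x, p x → p (c • x)) (x : V.Env) :
    p x := by
  have key : ∀ x y, p y → p (V.envMk x * y) := by
    intro x
    induction x using TensorAlgebra.induction with
    | algebraMap r =>
      intro y hy
      rw [AlgHom.commutes, ← Algebra.smul_def]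
      exact smul r y hy
    | ι m =>
      intro y hy
      induction m using DirectSum.induction_on with
      | zero => simpa using smul 0 y hy
      | of i a => exact gen_mul i a y hy
      | add a b ha hb =>
        rw [map_add, map_add, add_mul]
        exact add _ _ ha hb
    | mul a b ha hb =>
      intro y hy
      rw [map_mul, _root_.mul_assoc]
      exact ha _ (hb _ hy)
    | add a b ha hb =>
      intro y hy
      rw [map_add, add_mul]
      exact add _ _ (ha _ hy) (hb _ hy)
  obtain ⟨x, rfl⟩ := V.envMk_surjective x
  simpa using key x 1 one

theorem env_hom_ext (V : ULieAlg.{u, v} K) {B : Type*} [Ring B] [Algebra K B]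
    {f g : V.Env →ₐ[K] B} (h : ∀ i a, f (V.gen i a) = g (V.gen i a)) : f = g := by
  refine AlgHom.ext fun x => ?_
  induction x using V.env_induction with
  | one => simp
  | gen_mul i a x hx => rw [map_mul, map_mul, h, hx]
  | add x y hx hy => rw [map_add, map_add, hx, hy]
  | smul c x hx => rw [map_smul, map_smul, hx]

/-- The degree-`n` part of the enveloping algebra: the span of the (possibly empty) products
`v_1 ⋯ v_m` of homogeneous elements of `V` with `|v_1| + ⋯ + |v_m| = n`. -/
noncomputable def envDeg (V : ULieAlg.{u, v} K) (n : ℤ) : Submodule K V.Env :=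
  Submodule.span K {x | ∃ l : List (Σ i : ℤ, V.X.X i),
    (l.map Sigma.fst).sum = n ∧ (l.map fun p => V.gen p.1 p.2).prod = x}

theorem one_mem_envDeg (V : ULieAlg.{u, v} K) : (1 : V.Env) ∈ V.envDeg 0 :=
  Submodule.subset_span ⟨[], by simp, by simp⟩

theorem gen_mem_envDeg (V : ULieAlg.{u, v} K) (i : ℤ) (a : V.X.X i) : V.gen i a ∈ V.envDeg i :=
  Submodule.subset_span ⟨[⟨i, a⟩], by simp, by simp⟩

theorem mul_mem_envDeg (V : ULieAlg.{u, v} K) {i j k : ℤ} (h : i + j = k) {x y : V.Env}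
    (hx : x ∈ V.envDeg i) (hy : y ∈ V.envDeg j) : x * y ∈ V.envDeg k := by
  subst h
  have hle : V.envDeg i * V.envDeg j ≤ V.envDeg (i + j) := by
    rw [envDeg, envDeg, Submodule.span_mul_span, envDeg]
    apply Submodule.span_mono
    rintro _ ⟨_, ⟨l, hl, rfl⟩, _, ⟨m, hm, rfl⟩, rfl⟩
    exact ⟨l ++ m, by simp [hl, hm], by simp⟩
  exact hle (Submodule.mul_mem_mul hx hy)

theorem envDeg_induction (V : ULieAlg.{u, v} K) {p : ℤ → V.Env → Prop} (one : p 0 1)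
    (gen_mul : ∀ i j (a : V.X.X i) x, x ∈ V.envDeg j → p j x → p (i + j) (V.gen i a * x))
    (zero : ∀ n, p n 0)
    (add : ∀ n x y, p n x → p n y → p n (x + y))
    (smul : ∀ n (c : K) x, p n x → p n (c • x))
    {n : ℤ} {x : V.Env} (hx : x ∈ V.envDeg n) : p n x := by
  induction hx using Submodule.span_induction with
  | mem x h =>
    obtain ⟨l, rfl, rfl⟩ := h
    induction l with
    | nil => simpa using one
    | cons q l ih =>
      simp only [List.map_cons, List.sum_cons, List.prod_cons]
      exact gen_mul _ _ _ _ (Submodule.subset_span ⟨l, rfl, rfl⟩) ih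
  | zero => exact zero n
  | add x y _ _ hx hy => exact add n x y hx hy
  | smul c x _ hx => exact smul n c x hx

/-- Auxiliary `2 × 2`-matrices used to construct the differential of the enveloping algebra. -/
noncomputable def dMat (V : ULieAlg.{u, v} K) (i : ℤ) :
    V.X.X i →ₗ[K] Matrix (Fin 2) (Fin 2) V.Env where
  toFun a := !![i.negOnePow • V.gen i a, V.gen (i - 1) ((V.X.d i (i - 1)).hom a); 0, V.gen i a]
  map_add' a b := by
    ext s t
    fin_cases s <;> fin_cases t <;> simp
  map_smul' c a := by
    ext s t
    fin_cases s <;> fin_cases t <;> simp [Units.smul_def, smul_comm]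

theorem negOnePow_smul_smul_self {M : Type*} [AddCommGroup M] (i : ℤ) (x : M) :
    i.negOnePow • i.negOnePow • x = x := by
  rw [smul_smul, ← Int.negOnePow_add, Int.negOnePow_even _ ⟨i, rfl⟩, one_smul]

theorem dMat_comm (V : ULieAlg.{u, v} K) {i j k : ℤ} (h : i + j = k) (a : V.X.X i)
    (b : V.X.X j) :
    V.dMat i a * V.dMat j b - (i * j).negOnePow • (V.dMat j b * V.dMat i a) =
      V.dMat k (V.bracket h a b) := by
  have h1 := V.gen_comm h a b
  have h2 := V.gen_comm (show (i - 1) + j = k - 1 by omega) ((V.X.d i (i - 1)).hom a) b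
  have h3 := V.gen_comm (show i + (j - 1) = k - 1 by omega) a ((V.X.d j (j - 1)).hom b)
  have h4 := V.d_bracket (i' := i - 1) (j' := j - 1) (k' := k - 1) h (by omega) (by omega)
    (by omega) a b
  have e1 : ((i - 1) * j).negOnePow = (i * j).negOnePow * j.negOnePow := by
    rw [← Int.negOnePow_sub]; congr 1; ring
  have e2 : (i * (j - 1)).negOnePow = (i * j).negOnePow * i.negOnePow := by
    rw [← Int.negOnePow_sub]; congr 1; ring
  have e3 : k.negOnePow = i.negOnePow * j.negOnePow := by
    rw [← Int.negOnePow_add, h]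
  ext s t
  fin_cases s <;> fin_cases t
  · simp [dMat, ← h1, e3]
    simp only [smul_sub, Units.smul_def, mul_smul_comm, smul_smul, Units.val_mul]
    congr 2; ring
  · simp only [dMat, LinearMap.coe_mk, AddHom.coe_mk, Matrix.sub_apply, Matrix.smul_apply,
      Matrix.mul_apply, Fin.sum_univ_two, h4, map_add]
    have : V.gen (k - 1) (i.negOnePow • V.bracket (show i + (j - 1) = k - 1 by omega) a
        ((V.X.d j (j - 1)).hom b)) = i.negOnePow • V.gen (k - 1) (V.bracket
        (show i + (j - 1) = k - 1 by omega) a ((V.X.d j (j - 1)).hom b)) := by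
      simp [Units.smul_def]
    simp [this, ← h2, ← h3, e1, e2]
    have hi : ∀ x : V.Env, i.negOnePow • ((i * j).negOnePow * i.negOnePow) • x =
        (i * j).negOnePow • x := fun x => by
      rw [mul_comm, ← smul_smul, negOnePow_smul_smul_self]
    simp only [smul_sub, hi]
    simp only [Units.smul_def, smul_mul_assoc, smul_smul, Units.val_mul]
    abel
  · simp [dMat]
  · simp [dMat, ← h1]

theorem dMat_one (V : ULieAlg.{u, v} K) : V.dMat 0 V.one = 1 := by
  have := V.d_one
  ext s t
  fin_cases s <;> fin_cases t <;> simp [dMat, V.gen_one]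
  exact (congrArg _ this).trans (map_zero _)

/-- Auxiliary algebra map used to construct the differential of the enveloping algebra. -/
noncomputable def envDMat (V : ULieAlg.{u, v} K) : V.Env →ₐ[K] Matrix (Fin 2) (Fin 2) V.Env :=
  V.envLift V.dMat V.dMat_comm V.dMat_one

/-- The differential of the enveloping algebra. It is the unique linear map that extends the
differential of `V` (`envD_gen`) and satisfies the graded Leibniz rule (`envD_mul`). -/
noncomputable def envD (V : ULieAlg.{u, v} K) : V.Env →ₗ[K] V.Env :=
  Matrix.entryLinearMap K V.Env 0 1 ∘ₗ V.envDMat.toLinearMap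

theorem envD_gen (V : ULieAlg.{u, v} K) {i i' : ℤ} (hi : i' + 1 = i) (a : V.X.X i) :
    V.envD (V.gen i a) = V.gen i' ((V.X.d i i').hom a) := by
  obtain rfl : i' = i - 1 := by omega
  simp [envD, envDMat, dMat]

theorem envD_one (V : ULieAlg.{u, v} K) : V.envD 1 = 0 := by
  simp [envD]

theorem envDMat_one_one (V : ULieAlg.{u, v} K) (x : V.Env) :
    V.envDMat x 1 1 = x := by
  induction x using V.env_induction with
  | one => simp
  | gen_mul i a x hx => simp [Matrix.mul_apply, Fin.sum_univ_two, hx, envDMat, dMat] at hx ⊢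
  | add x y hx hy => simp [hx, hy]
  | smul c x hx => simp [hx]

theorem envD_gen_mul (V : ULieAlg.{u, v} K) (i : ℤ) (a : V.X.X i) (x : V.Env) :
    V.envD (V.gen i a * x) =
      V.envD (V.gen i a) * x + i.negOnePow • (V.gen i a * V.envD x) := by
  have h := V.envDMat_one_one x
  simp [envD, Matrix.mul_apply, Fin.sum_univ_two, h]
  simp [envDMat, dMat, add_comm, Units.smul_def, _root_.mul_assoc]

/-- The graded Leibniz rule. -/
theorem envD_mul (V : ULieAlg.{u, v} K) {i : ℤ} {x : V.Env} (hx : x ∈ V.envDeg i) (y : V.Env) :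
    V.envD (x * y) = V.envD x * y + i.negOnePow • (x * V.envD y) := by
  refine V.envDeg_induction
    (p := fun i x => V.envD (x * y) = V.envD x * y + i.negOnePow • (x * V.envD y))
    ?_ ?_ ?_ ?_ ?_ hx
  · simp [envD_one]
  · intro i j a x _ h
    rw [_root_.mul_assoc, envD_gen_mul, h, V.envD_gen_mul i a x, Int.negOnePow_add]
    simp only [mul_add, add_mul, smul_add, Units.smul_def, smul_mul_assoc, mul_smul_comm,
      smul_smul, Units.val_mul, _root_.mul_assoc]
    abel
  · simp
  · intro n x x' h h'
    simp only [add_mul, map_add, h, h', smul_add]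
    abel
  · intro n c x h
    simp only [smul_mul_assoc, map_smul, h, smul_add, smul_comm c]

theorem envD_mem (V : ULieAlg.{u, v} K) {i j : ℤ} (h : j + 1 = i) {x : V.Env}
    (hx : x ∈ V.envDeg i) : V.envD x ∈ V.envDeg j := by
  obtain rfl : j = i - 1 := by omega
  clear h
  refine V.envDeg_induction (p := fun i x => V.envD x ∈ V.envDeg (i - 1)) ?_ ?_ ?_ ?_ ?_ hx
  · simp [envD_one]
  · intro i j a x hx h
    rw [envD_gen_mul, V.envD_gen (i' := i - 1) (by omega), Units.smul_def]
    exact add_mem (V.mul_mem_envDeg (by omega) (V.gen_mem_envDeg _ _) hx)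
      (zsmul_mem (V.mul_mem_envDeg (by omega) (V.gen_mem_envDeg _ _) h) _)
  · simp
  · intro n x y hx hy
    rw [map_add]
    exact add_mem hx hy
  · intro n c x hx
    rw [map_smul]
    exact Submodule.smul_mem _ _ hx

theorem envD_envD (V : ULieAlg.{u, v} K) (x : V.Env) : V.envD (V.envD x) = 0 := by
  induction x using V.env_induction with
  | one => simp [envD_one]
  | gen_mul i a x hx =>
    have hd : (V.X.d (i - 1) (i - 2)).hom ((V.X.d i (i - 1)).hom a) = 0 := by
      rw [← LinearMap.comp_apply, ← ModuleCat.hom_comp, V.X.d_comp_d]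
      rfl
    have e : (i - 1).negOnePow = -i.negOnePow := by
      rw [Int.negOnePow_sub]; simp
    rw [envD_gen_mul, V.envD_gen (i' := i - 1) (by omega), map_add, envD_gen_mul,
      V.envD_gen (i := i - 1) (i' := i - 2) (by omega), hd,
      Units.smul_def i.negOnePow, map_zsmul, envD_gen_mul, hx,
      V.envD_gen (i' := i - 1) (by omega), e]
    simp [Units.smul_def]
  | add x y hx hy => rw [map_add, map_add, hx, hy, add_zero]
  | smul c x hx => rw [map_smul, map_smul, hx, smul_zero]

/-- The chain complex underlying the unital universal enveloping algebra. -/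
noncomputable def envComplex (V : ULieAlg.{u, v} K) : ChainComplex (ModuleCat.{max u v} K) ℤ where
  X n := ModuleCat.of K (V.envDeg n)
  d i j := if h : j + 1 = i then
    ModuleCat.ofHom (V.envD.restrict fun _ hx => V.envD_mem h hx) else 0
  shape i j h := dif_neg h
  d_comp_d' i j k hij hjk := by
    change j + 1 = i at hij
    change k + 1 = j at hjk
    rw [dif_pos hij, dif_pos hjk]
    ext x
    exact congrArg Subtype.val (Subtype.ext (V.envD_envD x.1) : (⟨_, _⟩ : V.envDeg k) = 0)

theorem envComplex_d_apply (V : ULieAlg.{u, v} K) {i j : ℤ} (h : j + 1 = i) (x : V.envDeg i) :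
    ((V.envComplex.d i j).hom x : V.envDeg j) = ⟨V.envD x.1, V.envD_mem h x.2⟩ := by
  change ((if h : j + 1 = i then
    ModuleCat.ofHom (V.envD.restrict fun _ hx => V.envD_mem h hx) else 0 :
      ModuleCat.of K (V.envDeg i) ⟶ ModuleCat.of K (V.envDeg j))).hom x = _
  rw [dif_pos h]
  rfl

/-- The multiplication of the enveloping algebra on homogeneous components. -/
noncomputable def envMul (V : ULieAlg.{u, v} K) {i j k : ℤ} (h : i + j = k) :
    V.envDeg i →ₗ[K] V.envDeg j →ₗ[K] V.envDeg k :=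
  LinearMap.mk₂ K (fun x y => ⟨x.1 * y.1, V.mul_mem_envDeg h x.2 y.2⟩)
    (fun _ _ _ => Subtype.ext (add_mul _ _ _)) (fun _ _ _ => Subtype.ext (smul_mul_assoc _ _ _))
    (fun _ _ _ => Subtype.ext (mul_add _ _ _)) (fun _ _ _ => Subtype.ext (mul_smul_comm _ _ _))

/-- The unital universal enveloping algebra `φ_!(V) = T V / I` as a differential graded algebra. -/
noncomputable def envelope (V : ULieAlg.{u, v} K) : AsAlg.{u, max u v} K where
  X := V.envComplex
  mul h := V.envMul h
  one := (⟨1, V.one_mem_envDeg⟩ : V.envDeg 0)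
  d_one := (V.envComplex_d_apply (by norm_num) _).trans (Subtype.ext V.envD_one)
  d_mul {i j k i' j' k'} h hi hj hk a b := by
    refine (V.envComplex_d_apply hk _).trans ?_
    rw [show (V.envComplex.d i i').hom a = _ from V.envComplex_d_apply hi a,
      show (V.envComplex.d j j').hom b = _ from V.envComplex_d_apply hj b]
    exact Subtype.ext (V.envD_mul a.2 b.1)
  mul_assoc _ _ _ a b c := Subtype.ext (_root_.mul_assoc a.1 b.1 c.1)
  one_mul a := Subtype.ext (_root_.one_mul a.1)
  mul_one a := Subtype.ext (_root_.mul_one a.1)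

/-- The algebra map between enveloping algebras induced by a morphism `f : V ⟶ W`; it extends
`f` multiplicatively (`envMap_gen`). -/
noncomputable def envMap {V W : ULieAlg.{u, v} K} (f : V ⟶ W) : V.Env →ₐ[K] W.Env :=
  V.envLift (fun i => W.gen i ∘ₗ (f.hom.f i).hom)
    (fun h a b => by
      simp only [LinearMap.comp_apply, f.map_bracket]
      exact W.gen_comm h _ _) (by simp [f.map_one, W.gen_one])

@[simp] theorem envMap_gen {V W : ULieAlg.{u, v} K} (f : V ⟶ W) (i : ℤ) (a : V.X.X i) :
    envMap f (V.gen i a) = W.gen i ((f.hom.f i).hom a) := by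
  simp [envMap]

theorem envMap_mem {V W : ULieAlg.{u, v} K} (f : V ⟶ W) {n : ℤ} {x : V.Env}
    (hx : x ∈ V.envDeg n) : envMap f x ∈ W.envDeg n := by
  refine V.envDeg_induction (p := fun n x => envMap f x ∈ W.envDeg n) ?_ ?_ ?_ ?_ ?_ hx
  · simpa using W.one_mem_envDeg
  · intro i j a x _ h
    rw [map_mul, envMap_gen]
    exact W.mul_mem_envDeg rfl (W.gen_mem_envDeg _ _) h
  · simp
  · intro n x y hx hy
    rw [map_add]
    exact add_mem hx hy
  · intro n c x hx
    rw [map_smul]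
    exact Submodule.smul_mem _ _ hx

theorem envMap_envD {V W : ULieAlg.{u, v} K} (f : V ⟶ W) (x : V.Env) :
    W.envD (envMap f x) = envMap f (V.envD x) := by
  induction x using V.env_induction with
  | one => simp [envD_one]
  | gen_mul i a x hx =>
    have hf : (W.X.d i (i - 1)).hom ((f.hom.f i).hom a) =
        (f.hom.f (i - 1)).hom ((V.X.d i (i - 1)).hom a) := by
      rw [← LinearMap.comp_apply, ← ModuleCat.hom_comp, f.hom.comm]
      rfl
    rw [map_mul, envMap_gen, envD_gen_mul, hx, envD_gen_mul, map_add, map_mul,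
      V.envD_gen (i' := i - 1) (by omega), W.envD_gen (i' := i - 1) (by omega), envMap_gen, hf,
      Units.smul_def, Units.smul_def, map_zsmul, map_mul, envMap_gen]
  | add x y hx hy => simp only [map_add, hx, hy]
  | smul c x hx => simp only [map_smul, hx]

/-- The morphism of differential graded algebras `φ_!(f)`. -/
noncomputable def envelopeMap {V W : ULieAlg.{u, v} K} (f : V ⟶ W) : V.envelope ⟶ W.envelope where
  hom :=
    { f := fun n => ModuleCat.ofHom
        ((envMap f).toLinearMap.restrict fun _ hx => envMap_mem f hx :
          V.envDeg n →ₗ[K] W.envDeg n)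
      comm' := fun i j h => by
        ext x
        refine (W.envComplex_d_apply h _).trans (Subtype.ext ?_)
        refine (envMap_envD f x.1).trans ?_
        exact (congrArg (fun y : V.envDeg j => envMap f y.1) (V.envComplex_d_apply h x)).symm }
  map_mul _ a b := Subtype.ext (map_mul (envMap f) a.1 b.1)
  map_one := Subtype.ext (map_one (envMap f))

end ULieAlg

end

/-- The unital universal enveloping algebra functor `φ_! : Alg_uLie ⥤ Alg_As`. -/
noncomputable def phiShriek (K : Type u) [Field K] :
    ULieAlg.{u, v} K ⥤ AsAlg.{u, max u v} K where
  obj V := V.envelope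
  map f := ULieAlg.envelopeMap f
  map_id V := by
    have h : ULieAlg.envMap (𝟙 V) = AlgHom.id K V.Env :=
      V.env_hom_ext fun i a => ULieAlg.envMap_gen _ i a
    refine AsAlg.Hom.ext ?_
    ext n x
    exact Subtype.ext (DFunLike.congr_fun h x.1)
  map_comp {U V W} f g := by
    have h : ULieAlg.envMap (f ≫ g) = (ULieAlg.envMap g).comp (ULieAlg.envMap f) :=
      U.env_hom_ext fun i a => by
        rw [ULieAlg.envMap_gen, AlgHom.comp_apply, ULieAlg.envMap_gen, ULieAlg.envMap_gen]
        rfl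
    refine AsAlg.Hom.ext ?_
    ext n x
    exact Subtype.ext (DFunLike.congr_fun h x.1)

/-- A morphism of unital Lie algebras is a weak equivalence if the underlying chain map is a
quasi-isomorphism. -/
def ULieAlg.weakEquivalences (K : Type u) [Field K] : MorphismProperty (ULieAlg.{u, v} K) :=
  fun _ _ f => QuasiIso f.hom

/-- A morphism of differential graded algebras is a weak equivalence if the underlying chain map
is a quasi-isomorphism. -/
def AsAlg.weakEquivalences (K : Type u) [Field K] : MorphismProperty (AsAlg.{u, v} K) :=
  fun _ _ f => QuasiIso f.hom

/-! In characteristic zero the Poincaré-Birkhoff-Witt theorem holds for unital Lie algebras in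
complexes. Let `V.ab` be `V` with zero bracket. Graded symmetrization is an isomorphism of complexes
from the enveloping algebra of `V.ab` to that of `V`, natural in `V` (`exists_pbw`, `envD_pbw`,
`envMap_pbw`). Hence, as a complex, the enveloping algebra depends only on the complex `V` with its
marked cycle, and it suffices to treat zero brackets (`quasiIso_envelopeMap_of_ab`).

If the unit of `W` is nonzero, a quasi-isomorphism over a field has a homotopy inverse for which the
inverse and both homotopies respect the units (`exists_pointed_homotopy_inverse`). Such data extend
to products of letters, and after symmetrization they descend to the enveloping algebras with zero
bracket (`exists_env_homotopy`). If the unit of `W` is zero, injectivity on homology makes the unit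
of `V` a boundary. Then the units of both enveloping algebras are boundaries, and both algebras are
contractible.

The PBW theorem is proved dually. A linear map out of the enveloping algebra is the same as a
multilinear function on words of homogeneous letters that respects the commutator and unit relations
(`exists_env_linearMap`). Given a graded symmetric function, a function with the commutator relation
and with this symmetrization is built by recursion on the word length. In each length the relation
says that the function is fixed by signed exchanges corrected by bracket terms of shorter words.
Antisymmetry and the Jacobi identity give these affine operators the Coxeter relations of the
symmetric group (`isCoxeterA_affOp`), so averaging over that group produces a fixed point.
Uniqueness follows because, once shorter words agree, the difference of two solutions is symmetric
(`IsLieFun.ext`). -/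

/-! ### Averages over symmetric groups, from the Coxeter relations alone -/

section Symmetrizer

variable {R : Type*} [Ring R]

/-- The first `m` members of the sequence `s` satisfy the defining relations of the adjacent
transpositions in the symmetric group on `m + 1` letters. -/
structure IsCoxeterA (s : ℕ → R) (m : ℕ) : Prop where
  sq : ∀ i, i < m → s i * s i = 1
  braid : ∀ i, i + 1 < m → s i * s (i + 1) * s i = s (i + 1) * s i * s (i + 1)
  comm : ∀ i j, i + 2 ≤ j → j < m → s i * s j = s j * s i

theorem IsCoxeterA.mono {s : ℕ → R} {m n : ℕ} (h : IsCoxeterA s n) (hmn : m ≤ n) :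
    IsCoxeterA s m where
  sq i hi := h.sq i (by omega)
  braid i hi := h.braid i (by omega)
  comm i j hij hj := h.comm i j hij (by omega)

/-- The sum `1 + s_{m-1} + s_{m-2} s_{m-1} + ⋯ + s_0 ⋯ s_{m-1}`. -/
def cosetSum (s : ℕ → R) : ℕ → R
  | 0 => 1
  | m + 1 => 1 + cosetSum s m * s m

theorem cosetSum_comm {s : ℕ → R} {m : ℕ} {x : R} (h : ∀ i, i < m → s i * x = x * s i) :
    cosetSum s m * x = x * cosetSum s m := by
  induction m with
  | zero => simp [cosetSum]
  | succ m ih =>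
    rw [cosetSum, add_mul, mul_add, one_mul, mul_one, mul_assoc, h m (by omega), ← mul_assoc,
      ih fun i hi => h i (by omega), mul_assoc]

/-- The terms of the sum represent the left cosets of the subgroup generated by the first `m`
transpositions. A generator permutes these cosets, and `e` absorbs the subgroup. The argument uses
only the relations, so no action of an actual permutation group is needed. -/
theorem IsCoxeterA.mul_cosetSum {s : ℕ → R} {m : ℕ} (h : IsCoxeterA s (m + 1)) {e : R}
    (he : ∀ i, i < m → s i * e = e) (i : ℕ) (hi : i < m + 1) :
    s i * (cosetSum s (m + 1) * e) = cosetSum s (m + 1) * e := by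
  induction m generalizing e i with
  | zero =>
    obtain rfl : i = 0 := by omega
    simp only [cosetSum, one_mul, add_mul, mul_add, ← mul_assoc, h.sq 0 (by omega)]
    abel
  | succ m ih =>
    rcases Nat.lt_or_ge i (m + 1) with hi' | hi'
    · have h1 := ih (h.mono (by omega)) (e := s (m + 1) * e) (fun k hk => by
        rw [← mul_assoc, h.comm k (m + 1) (by omega) (by omega), mul_assoc, he k (by omega)]) i hi'
      rw [cosetSum, add_mul, one_mul, mul_add, he i hi', mul_assoc, h1]
    · obtain rfl : i = m + 1 := by omega
      -- The element is `e + s (m + 1) * e + cosetSum s m * s m * s (m + 1) * e`. Multiplication by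
      -- `s (m + 1)` exchanges the first two terms and, by the braid relation, fixes the third.
      have hc := cosetSum_comm (s := s) (m := m) (x := s (m + 1))
        (fun k hk => h.comm k (m + 1) (by omega) (by omega))
      have h2 : s (m + 1) * (cosetSum s m * (s m * (s (m + 1) * e))) =
          cosetSum s m * (s m * (s (m + 1) * e)) := by
        rw [← mul_assoc, ← hc, mul_assoc, ← mul_assoc (s m), ← mul_assoc (s (m + 1)),
          ← mul_assoc (s (m + 1)), ← h.braid m (by omega), mul_assoc, mul_assoc, he m (by omega), mul_assoc]
      simp only [cosetSum, add_mul, mul_add, one_mul, mul_assoc, h2]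
      rw [← mul_assoc (s (m + 1)) (s (m + 1)), h.sq _ (by omega), one_mul]
      abel

variable (K : Type u) [Field K] [Algebra K R]

/-- The average over the symmetric group generated by `s_0, …, s_{m-1}`. -/
noncomputable def symmetrizer (s : ℕ → R) : ℕ → R
  | 0 => 1
  -- The coset sum over `m + 1` generators has `m + 2` terms.
  | m + 1 => (m + 2 : K)⁻¹ • (cosetSum s (m + 1) * symmetrizer s m)

theorem IsCoxeterA.mul_symmetrizer {s : ℕ → R} {m : ℕ} (h : IsCoxeterA s m) (i : ℕ) (hi : i < m) :
    s i * symmetrizer K s m = symmetrizer K s m := by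
  induction m generalizing i with
  | zero => omega
  | succ m ih =>
    rw [symmetrizer, mul_smul_comm, h.mul_cosetSum (fun k hk => ih (h.mono (by omega)) k hk) i hi]

theorem mul_cosetSum_of_fixed {s : ℕ → R} {m : ℕ} {x : R} (h : ∀ i, i < m → x * s i = x) :
    x * cosetSum s m = (m + 1 : K) • x := by
  induction m with
  | zero => simp [cosetSum]
  | succ m ih =>
    rw [cosetSum, mul_add, ← mul_assoc, ih fun i hi => h i (by omega), smul_mul_assoc,
      h m (by omega), mul_one]
    push_cast
    module

theorem mul_symmetrizer_of_fixed [CharZero K] {s : ℕ → R} {m : ℕ} {x : R}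
    (h : ∀ i, i < m → x * s i = x) : x * symmetrizer K s m = x := by
  induction m with
  | zero => simp [symmetrizer]
  | succ m ih =>
    have hm : (m + 2 : K) ≠ 0 := by exact_mod_cast (show m + 2 ≠ 0 by omega)
    rw [symmetrizer, mul_smul_comm, ← mul_assoc, mul_cosetSum_of_fixed K h, smul_mul_assoc,
      ih fun i hi => h i (by omega), smul_smul]
    push_cast
    rw [add_assoc, one_add_one_eq_two, inv_mul_cancel₀ hm, one_smul]

/-- The average formed in the opposite ring is invariant on the other side. Multiplying the two
averages gives each of them, so they coincide and the average is invariant on both sides. -/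
theorem IsCoxeterA.symmetrizer_mul [CharZero K] {s : ℕ → R} {m : ℕ} (h : IsCoxeterA s m) (i : ℕ)
    (hi : i < m) : symmetrizer K s m * s i = symmetrizer K s m := by
  have hop : IsCoxeterA (fun i => MulOpposite.op (s i)) m :=
    ⟨fun i hi => by rw [← MulOpposite.op_mul, h.sq i hi, MulOpposite.op_one],
      fun i hi => by simp only [← MulOpposite.op_mul, ← mul_assoc, h.braid i hi],
      fun i j hij hj => by simp only [← MulOpposite.op_mul, h.comm i j hij hj]⟩
  obtain ⟨e, he⟩ := MulOpposite.op_surjective (symmetrizer K (fun i => MulOpposite.op (s i)) m)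
  have hright : ∀ j, j < m → e * s j = e := fun j hj => by
    have := hop.mul_symmetrizer K j hj
    rwa [← he, ← MulOpposite.op_mul, MulOpposite.op_inj] at this
  have h1 : e * symmetrizer K s m = symmetrizer K s m := by
    have := mul_symmetrizer_of_fixed K (s := fun i => MulOpposite.op (s i)) (m := m)
      (x := MulOpposite.op (symmetrizer K s m)) fun j hj => by
        rw [← MulOpposite.op_mul, h.mul_symmetrizer K j hj]
    rwa [← he, ← MulOpposite.op_mul, MulOpposite.op_inj] at this
  rw [← h1, mul_symmetrizer_of_fixed K hright, hright i hi]

end Symmetrizer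

/-! ### Symmetrizers as operators on a vector space -/

section SymmetrizerModule

variable {K : Type u} [Field K] {Y Y' : Type*} [AddCommGroup Y] [Module K Y] [AddCommGroup Y']
  [Module K Y']

theorem cosetSum_apply_of_fixed {s : ℕ → Module.End K Y} {m : ℕ} {y : Y}
    (h : ∀ i, i < m → s i y = y) : cosetSum s m y = (m + 1 : K) • y := by
  induction m with
  | zero => simp [cosetSum]
  | succ m ih =>
    simp only [cosetSum, LinearMap.add_apply, Module.End.mul_apply, Module.End.one_apply,
      h m (by omega), ih fun i hi => h i (by omega)]
    push_cast
    module

theorem symmetrizer_apply_of_fixed [CharZero K] {s : ℕ → Module.End K Y} {m : ℕ} {y : Y}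
    (h : ∀ i, i < m → s i y = y) : symmetrizer K s m y = y := by
  induction m with
  | zero => simp [symmetrizer]
  | succ m ih =>
    have hm : (m + 2 : K) ≠ 0 := by exact_mod_cast (show m + 2 ≠ 0 by omega)
    rw [symmetrizer, LinearMap.smul_apply, Module.End.mul_apply, ih fun i hi => h i (by omega),
      cosetSum_apply_of_fixed h, smul_smul]
    push_cast
    rw [add_assoc, one_add_one_eq_two, inv_mul_cancel₀ hm, one_smul]

theorem map_cosetSum (A : Y →ₗ[K] Y') {s : ℕ → Module.End K Y} {s' : ℕ → Module.End K Y'} {m : ℕ}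
    (h : ∀ i, i < m → ∀ y, A (s i y) = s' i (A y)) (y : Y) :
    A (cosetSum s m y) = cosetSum s' m (A y) := by
  induction m generalizing y with
  | zero => simp [cosetSum]
  | succ m ih =>
    simp only [cosetSum, LinearMap.add_apply, Module.End.mul_apply, Module.End.one_apply, map_add,
      ih (fun i hi => h i (by omega)), h m (by omega)]

theorem map_symmetrizer (A : Y →ₗ[K] Y') {s : ℕ → Module.End K Y} {s' : ℕ → Module.End K Y'}
    {m : ℕ} (h : ∀ i, i < m → ∀ y, A (s i y) = s' i (A y)) (y : Y) :
    A (symmetrizer K s m y) = symmetrizer K s' m (A y) := by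
  induction m with
  | zero => simp [symmetrizer]
  | succ m ih =>
    simp only [symmetrizer, LinearMap.smul_apply, Module.End.mul_apply, map_smul,
      map_cosetSum A h, ih fun i hi => h i (by omega)]

theorem cosetSum_mem {s : ℕ → Module.End K Y} {m : ℕ} (p : Submodule K Y)
    (h : ∀ i, i < m → ∀ y ∈ p, s i y ∈ p) {y : Y} (hy : y ∈ p) : cosetSum s m y ∈ p := by
  induction m generalizing y with
  | zero => simpa [cosetSum]
  | succ m ih =>
    exact add_mem hy (ih (fun i hi => h i (by omega)) (h m (by omega) y hy))

theorem symmetrizer_mem {s : ℕ → Module.End K Y} {m : ℕ} (p : Submodule K Y)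
    (h : ∀ i, i < m → ∀ y ∈ p, s i y ∈ p) {y : Y} (hy : y ∈ p) : symmetrizer K s m y ∈ p := by
  induction m with
  | zero => simpa [symmetrizer]
  | succ m ih =>
    exact p.smul_mem _ (cosetSum_mem p h (ih fun i hi => h i (by omega)))

/-- The subspace `p` is there for `symFun_append_singleton`, where the invariance of `A` is known
only on functions indifferent to the position of one letter. -/
theorem map_symmetrizer_of_invariant [CharZero K] (A : Y →ₗ[K] Y') {s : ℕ → Module.End K Y} {m : ℕ}
    (p : Submodule K Y) (hp : ∀ i, i < m → ∀ y ∈ p, s i y ∈ p)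
    (hA : ∀ i, i < m → ∀ y ∈ p, A (s i y) = A y) {y : Y} (hy : y ∈ p) :
    A (symmetrizer K s m y) = A y := by
  have hsum : ∀ k ≤ m, ∀ y ∈ p, A (cosetSum s k y) = (k + 1 : K) • A y := by
    intro k
    induction k with
    | zero => simp [cosetSum]
    | succ k ih =>
      intro hk y hy
      simp only [cosetSum, LinearMap.add_apply, Module.End.mul_apply, Module.End.one_apply,
        map_add, ih (by omega) _ (hp k hk y hy), hA k hk y hy]
      push_cast
      module
  induction m with
  | zero => simp [symmetrizer]
  | succ m ih =>
    have hm : (m + 2 : K) ≠ 0 := by exact_mod_cast (show m + 2 ≠ 0 by omega)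
    have hmem := symmetrizer_mem (K := K) p (fun i hi => hp i (Nat.lt_succ_of_lt hi)) hy
    rw [symmetrizer, LinearMap.smul_apply, Module.End.mul_apply, map_smul,
      hsum _ le_rfl _ hmem, ih (fun i hi => hp i (by omega)) (fun i hi => hA i (by omega))
      (fun k hk => hsum k (by omega)), smul_smul]
    push_cast
    rw [add_assoc, one_add_one_eq_two, inv_mul_cancel₀ hm, one_smul]

end SymmetrizerModule

/-! ### Words of homogeneous letters and graded symmetrization -/

section Words

variable {A : ℤ → Type v}

/-- Exchange the letters in positions `i` and `i + 1`. -/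
def swapAt : ℕ → List (Sigma A) → List (Sigma A)
  | 0, a :: b :: l => b :: a :: l
  | i + 1, a :: l => a :: swapAt i l
  | _, l => l

/-- The Koszul sign of `swapAt`. -/
def swapSign : ℕ → List (Sigma A) → ℤˣ
  | 0, a :: b :: _ => (a.1 * b.1).negOnePow
  | i + 1, _ :: l => swapSign i l
  | _, _ => 1

theorem swapAt_append (p q : List (Sigma A)) (a b : Sigma A) :
    swapAt p.length (p ++ a :: b :: q) = p ++ b :: a :: q := by
  induction p with
  | nil => rfl
  | cons c p ih => simp [swapAt, ih]

theorem swapSign_append (p q : List (Sigma A)) (a b : Sigma A) :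
    swapSign p.length (p ++ a :: b :: q) = (a.1 * b.1).negOnePow := by
  induction p with
  | nil => rfl
  | cons c p ih => simp [swapSign, ih]

@[simp] theorem length_swapAt (i : ℕ) (l : List (Sigma A)) : (swapAt i l).length = l.length := by
  induction i generalizing l with
  | zero => rcases l with _ | ⟨a, _ | ⟨b, l⟩⟩ <;> simp [swapAt]
  | succ i ih => rcases l with _ | ⟨a, l⟩ <;> simp [swapAt, ih]

@[simp] theorem swapAt_swapAt (i : ℕ) (l : List (Sigma A)) : swapAt i (swapAt i l) = l := by
  induction i generalizing l with
  | zero => rcases l with _ | ⟨a, _ | ⟨b, l⟩⟩ <;> simp [swapAt]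
  | succ i ih => rcases l with _ | ⟨a, l⟩ <;> simp [swapAt, ih]

theorem swapSign_mul_swapSign (i : ℕ) (l : List (Sigma A)) :
    swapSign i l * swapSign i (swapAt i l) = 1 := by
  induction i generalizing l with
  | zero =>
    rcases l with _ | ⟨a, _ | ⟨b, l⟩⟩
    · simp [swapAt, swapSign]
    · simp [swapAt, swapSign]
    · simp only [swapAt, swapSign]
      rw [mul_comm b.1, ← Int.negOnePow_add, Int.negOnePow_even _ ⟨_, rfl⟩]
  | succ i ih => rcases l with _ | ⟨a, l⟩ <;> simp [swapAt, swapSign, ih]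

theorem exists_eq_append_of_lt {i : ℕ} {l : List (Sigma A)} (h : i + 1 < l.length) :
    ∃ p a b q, p.length = i ∧ l = p ++ a :: b :: q := by
  induction i generalizing l with
  | zero =>
    rcases l with _ | ⟨a, _ | ⟨b, l⟩⟩
    · simp at h
    · simp at h
    · exact ⟨[], a, b, l, rfl, rfl⟩
  | succ i ih =>
    rcases l with _ | ⟨c, l⟩
    · simp at h
    · obtain ⟨p, a, b, q, hp, rfl⟩ := ih (l := l) (by simpa using h)
      exact ⟨c :: p, a, b, q, by simp [hp], rfl⟩

theorem swapAt_comm {i j : ℕ} (h : i + 2 ≤ j) (l : List (Sigma A)) :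
    swapAt i (swapAt j l) = swapAt j (swapAt i l) := by
  induction i generalizing j l with
  | zero =>
    obtain ⟨j, rfl⟩ := Nat.exists_eq_add_of_le' h
    rcases l with _ | ⟨a, _ | ⟨b, l⟩⟩ <;> simp [swapAt]
  | succ i ih =>
    obtain ⟨j, rfl⟩ := Nat.exists_eq_add_of_le' (show 1 ≤ j by omega)
    rcases l with _ | ⟨a, l⟩ <;> simp [swapAt, ih (show i + 2 ≤ j by omega)]

theorem swapSign_swapAt_of_le {i j : ℕ} (h : i + 2 ≤ j) (l : List (Sigma A)) :
    swapSign i (swapAt j l) = swapSign i l ∧ swapSign j (swapAt i l) = swapSign j l := by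
  induction i generalizing j l with
  | zero =>
    obtain ⟨j, rfl⟩ := Nat.exists_eq_add_of_le' h
    rcases l with _ | ⟨a, _ | ⟨b, l⟩⟩ <;> simp [swapAt, swapSign]
  | succ i ih =>
    obtain ⟨j, rfl⟩ := Nat.exists_eq_add_of_le' (show 1 ≤ j by omega)
    rcases l with _ | ⟨a, l⟩ <;> simp [swapAt, swapSign, ih (show i + 2 ≤ j by omega)]

theorem swapAt_braid {i : ℕ} {l : List (Sigma A)} (h : i + 2 < l.length) :
    swapAt i (swapAt (i + 1) (swapAt i l)) = swapAt (i + 1) (swapAt i (swapAt (i + 1) l)) := by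
  induction i generalizing l with
  | zero =>
    rcases l with _ | ⟨a, _ | ⟨b, _ | ⟨c, l⟩⟩⟩ <;> simp [swapAt] at h ⊢
  | succ i ih =>
    rcases l with _ | ⟨a, l⟩
    · simp at h
    · simpa [swapAt] using ih (by simp at h; omega)

theorem swapSign_braid {i : ℕ} {l : List (Sigma A)} (h : i + 2 < l.length) :
    swapSign i l * swapSign (i + 1) (swapAt i l) * swapSign i (swapAt (i + 1) (swapAt i l)) =
      swapSign (i + 1) l * swapSign i (swapAt (i + 1) l) *
        swapSign (i + 1) (swapAt i (swapAt (i + 1) l)) := by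
  induction i generalizing l with
  | zero =>
    rcases l with _ | ⟨a, _ | ⟨b, _ | ⟨c, l⟩⟩⟩ <;> simp [swapAt, swapSign] at h ⊢
    rw [mul_comm, mul_comm (Int.negOnePow _) (Int.negOnePow (a.1 * c.1)), mul_assoc]
  | succ i ih =>
    rcases l with _ | ⟨a, l⟩
    · simp at h
    · simpa [swapAt, swapSign] using ih (by simp at h; omega)

variable (K : Type u) [Field K] (M : Type*) [AddCommGroup M] [Module K M]

/-- The signed exchange of the arguments in positions `i` and `i + 1` of functions of words of
length `n`. -/
def swapOp (n i : ℕ) : Module.End K (List (Sigma A) → M) where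
  -- Fixing the length preserves the braid relation: a word with exactly `i + 2` letters is affected
  -- by the exchange `i` but not by the exchange `i + 1`.
  toFun F l := if l.length = n then swapSign i l • F (swapAt i l) else F l
  map_add' F G := by ext l; by_cases h : l.length = n <;> simp [h]
  map_smul' c F := by ext l; by_cases h : l.length = n <;> simp [h, smul_comm c]

variable {K M}

theorem swapOp_apply {n i : ℕ} (F : List (Sigma A) → M) {l : List (Sigma A)} (h : l.length = n) :
    swapOp K M n i F l = swapSign i l • F (swapAt i l) := if_pos h

theorem swapOp_apply_of_ne {n i : ℕ} (F : List (Sigma A) → M) {l : List (Sigma A)}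
    (h : l.length ≠ n) : swapOp K M n i F l = F l := if_neg h

theorem swapOp_append {n : ℕ} (F : List (Sigma A) → M) {p q : List (Sigma A)} (a b : Sigma A)
    (h : p.length + q.length + 2 = n) :
    swapOp K M n p.length F (p ++ a :: b :: q) =
      (a.1 * b.1).negOnePow • F (p ++ b :: a :: q) := by
  rw [swapOp_apply _ (by simp; omega), swapAt_append, swapSign_append]

theorem isCoxeterA_swapOp (n : ℕ) : IsCoxeterA (swapOp (A := A) K M n) (n - 1) where
  sq i hi := by
    ext F l
    by_cases h : l.length = n
    · simp [Module.End.mul_apply, swapOp_apply _ h, swapOp_apply (l := swapAt i l) _ (by simpa using h),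
        smul_smul, swapSign_mul_swapSign]
    · simp [Module.End.mul_apply, swapOp_apply_of_ne _ h]
  braid i hi := by
    ext F l
    by_cases h : l.length = n
    · have h' : ∀ (G : List (Sigma A) → M) j k, swapOp K M n j G (swapAt k l) =
          swapSign j (swapAt k l) • G (swapAt j (swapAt k l)) :=
        fun G j k => swapOp_apply _ (by simpa using h)
      have h'' : ∀ (G : List (Sigma A) → M) j k m, swapOp K M n j G (swapAt k (swapAt m l)) =
          swapSign j (swapAt k (swapAt m l)) • G (swapAt j (swapAt k (swapAt m l))) :=
        fun G j k m => swapOp_apply _ (by simpa using h)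
      simp only [Module.End.mul_apply, swapOp_apply _ h, h', h'', smul_smul, ← mul_assoc]
      rw [swapSign_braid (by omega), swapAt_braid (by omega)]
    · simp [Module.End.mul_apply, swapOp_apply_of_ne _ h]
  comm i j hij hj := by
    ext F l
    by_cases h : l.length = n
    · have h' : ∀ (G : List (Sigma A) → M) j k, swapOp K M n j G (swapAt k l) =
          swapSign j (swapAt k l) • G (swapAt j (swapAt k l)) :=
        fun G j k => swapOp_apply _ (by simpa using h)
      simp only [Module.End.mul_apply, swapOp_apply _ h, h', smul_smul]
      rw [swapAt_comm hij, (swapSign_swapAt_of_le hij l).1, (swapSign_swapAt_of_le hij l).2,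
        mul_comm]
    · simp [Module.End.mul_apply, swapOp_apply_of_ne _ h]

variable (K M) in
/-- The graded symmetrization of functions of words of length `n`. -/
noncomputable def symOp (n : ℕ) : Module.End K (List (Sigma A) → M) :=
  symmetrizer K (swapOp K M n) (n - 1)

variable (K) in
/-- The graded symmetrization of a function of words. -/
noncomputable def symFun (F : List (Sigma A) → M) (l : List (Sigma A)) : M :=
  symOp K M l.length F l

/-- Graded symmetric functions of words. -/
def IsSymmFun (F : List (Sigma A) → M) : Prop :=
  ∀ p a b q, F (p ++ a :: b :: q) = (a.1 * b.1).negOnePow • F (p ++ b :: a :: q)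

theorem IsSymmFun.comp {M' : Type*} [AddCommGroup M'] [Module K M'] {F : List (Sigma A) → M}
    (hF : IsSymmFun F) (φ : M →ₗ[K] M') : IsSymmFun (φ ∘ F) := by
  intro p a b q
  simp only [Function.comp_apply, hF p a b q, Units.smul_def, map_zsmul]

theorem IsSymmFun.swapOp {F : List (Sigma A) → M} (hF : IsSymmFun F) {n i : ℕ} (hi : i < n - 1) :
    swapOp K M n i F = F := by
  ext l
  by_cases h : l.length = n
  · obtain ⟨p, a, b, q, rfl, rfl⟩ := exists_eq_append_of_lt (i := i) (l := l) (by omega)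
    rw [swapOp_append _ _ _ (by simpa [← add_assoc] using h), ← hF]
  · exact swapOp_apply_of_ne _ h

theorem IsSymmFun.symFun_eq [CharZero K] {F : List (Sigma A) → M} (hF : IsSymmFun F) :
    symFun K F = F := by
  ext l
  exact congrFun (symmetrizer_apply_of_fixed fun i hi => hF.swapOp hi) l

theorem swapOp_symOp {n i : ℕ} (hi : i < n - 1) (F : List (Sigma A) → M) :
    swapOp K M n i (symOp K M n F) = symOp K M n F :=
  DFunLike.congr_fun ((isCoxeterA_swapOp n).mul_symmetrizer K i hi) F

theorem symFun_isSymmFun (F : List (Sigma A) → M) : IsSymmFun (symFun K F) := by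
  intro p a b q
  have h := congrFun (swapOp_symOp (K := K) (n := p.length + q.length + 2) (i := p.length)
    (by omega) F) (p ++ a :: b :: q)
  rw [swapOp_append _ _ _ rfl] at h
  rw [symFun, symFun, show (p ++ a :: b :: q).length = p.length + q.length + 2 by simp; omega,
    show (p ++ b :: a :: q).length = p.length + q.length + 2 by simp; omega, h]

/-- Symmetrization commutes with operators that commute with the exchanges of arguments. -/
theorem map_symOp {A' : ℤ → Type*} {M' : Type*} [AddCommGroup M'] [Module K M']
    (B : (List (Sigma A) → M) →ₗ[K] (List (Sigma A') → M')) {n : ℕ}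
    (h : ∀ i, i < n - 1 → ∀ F, B (swapOp K M n i F) = swapOp K M' n i (B F))
    (F : List (Sigma A) → M) : B (symOp K M n F) = symOp K M' n (B F) :=
  map_symmetrizer B h F

theorem symOp_congr {n : ℕ} {F G : List (Sigma A) → M} (h : ∀ l, l.length = n → F l = G l)
    {l : List (Sigma A)} (hl : l.length = n) : symOp K M n F l = symOp K M n G l := by
  let p : Submodule K (List (Sigma A) → M) :=
    { carrier := {F | ∀ l, l.length = n → F l = 0}
      zero_mem' := fun _ _ => rfl
      add_mem' := fun h h' l hl => by simp [h l hl, h' l hl]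
      smul_mem' := fun c F h l hl => by simp [h l hl] }
  have hp : F - G ∈ p := fun l hl => by simp [h l hl]
  have := symmetrizer_mem (K := K) (s := swapOp K M n) (m := n - 1) p
    (fun i _ F hF l hl => by rw [swapOp_apply _ hl, hF _ (by simpa using hl), smul_zero]) hp l hl
  rw [← sub_eq_zero]
  simpa [symOp] using this

theorem symFun_comp {M' : Type*} [AddCommGroup M'] [Module K M'] (φ : M →ₗ[K] M')
    (F : List (Sigma A) → M) : symFun K (φ ∘ F) = φ ∘ symFun K F := by
  ext l
  refine (congrFun (map_symOp (φ.compLeft (List (Sigma A))) ?_ F) l).symm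
  intro i _ G
  ext l'
  by_cases h : l'.length = l.length
  · simp [swapOp_apply _ h, Units.smul_def]
  · simp [swapOp_apply_of_ne _ h]

/-! ### Symmetrization in the presence of a letter of degree zero that can be moved freely -/

section Central

/-- Insert the letter `c` at position `j`. -/
def insAt (c : Sigma A) : ℕ → List (Sigma A) → List (Sigma A)
  | j + 1, a :: l => a :: insAt c j l
  | _, l => c :: l

theorem insAt_length (c : Sigma A) (l : List (Sigma A)) : insAt c l.length l = l ++ [c] := by
  induction l with
  | nil => rfl
  | cons a l ih => simp [insAt, ih]

@[simp] theorem length_insAt (c : Sigma A) (j : ℕ) (l : List (Sigma A)) :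
    (insAt c j l).length = l.length + 1 := by
  induction j generalizing l with
  | zero => simp [insAt]
  | succ j ih => rcases l with _ | ⟨a, l⟩ <;> simp [insAt, ih]

theorem exists_insAt_eq (c : Sigma A) (j : ℕ) (l : List (Sigma A)) :
    ∃ p q, insAt c j l = p ++ c :: q ∧ l = p ++ q := by
  induction j generalizing l with
  | zero => exact ⟨[], l, by simp [insAt], rfl⟩
  | succ j ih =>
    rcases l with _ | ⟨a, l⟩
    · exact ⟨[], [], by simp [insAt], rfl⟩
    · obtain ⟨p, q, h, rfl⟩ := ih l
      exact ⟨a :: p, q, by simp [insAt, h], rfl⟩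

theorem swap_insAt_of_add_two_le (c : Sigma A) {i j : ℕ} (h : i + 2 ≤ j) {l : List (Sigma A)}
    (hl : j ≤ l.length) : swapAt i (insAt c j l) = insAt c j (swapAt i l) ∧
      swapSign i (insAt c j l) = swapSign i l := by
  induction i generalizing j l with
  | zero =>
    obtain ⟨j, rfl⟩ := Nat.exists_eq_add_of_le' h
    rcases l with _ | ⟨a, _ | ⟨b, l⟩⟩ <;> simp [swapAt, swapSign, insAt] at hl ⊢
  | succ i ih =>
    obtain ⟨j, rfl⟩ := Nat.exists_eq_add_of_le' (show 1 ≤ j by omega)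
    rcases l with _ | ⟨a, l⟩
    · simp at hl
    · simpa [swapAt, swapSign, insAt] using ih (j := j) (l := l) (by omega) (by simpa using hl)

theorem swap_insAt_of_lt (c : Sigma A) {i j : ℕ} (h : j ≤ i) {l : List (Sigma A)}
    (hl : j ≤ l.length) : swapAt (i + 1) (insAt c j l) = insAt c j (swapAt i l) ∧
      swapSign (i + 1) (insAt c j l) = swapSign i l := by
  induction j generalizing i l with
  | zero => simp [insAt, swapAt, swapSign]
  | succ j ih =>
    obtain ⟨i, rfl⟩ := Nat.exists_eq_add_of_le' (show 1 ≤ i by omega)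
    rcases l with _ | ⟨a, l⟩
    · simp at hl
    · simpa [swapAt, swapSign, insAt] using ih (i := i) (l := l) (by omega) (by simpa using hl)

theorem swap_insAt_self {c : Sigma A} (hc : c.1 = 0) {j : ℕ} {l : List (Sigma A)}
    (hl : j < l.length) : swapAt j (insAt c j l) = insAt c (j + 1) l ∧
      swapAt j (insAt c (j + 1) l) = insAt c j l ∧
      swapSign j (insAt c j l) = 1 ∧ swapSign j (insAt c (j + 1) l) = 1 := by
  induction j generalizing l with
  | zero =>
    rcases l with _ | ⟨a, l⟩
    · simp at hl
    · simp [insAt, swapAt, swapSign, hc]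
  | succ j ih =>
    rcases l with _ | ⟨a, l⟩
    · simp at hl
    · simpa [swapAt, swapSign, insAt] using ih (l := l) (by simpa using hl)

variable (K M) in
/-- Evaluation at a fixed letter `c` in position `j`, for functions of words of length `n + 1`. -/
def insOp (c : Sigma A) (n j : ℕ) : Module.End K (List (Sigma A) → M) where
  toFun F l := if l.length = n then F (insAt c j l) else 0
  map_add' F G := by ext l; by_cases h : l.length = n <;> simp [h]
  map_smul' r F := by ext l; by_cases h : l.length = n <;> simp [h]

theorem insOp_apply {c : Sigma A} {n j : ℕ} (F : List (Sigma A) → M) {l : List (Sigma A)}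
    (h : l.length = n) : insOp K M c n j F l = F (insAt c j l) := if_pos h

theorem insOp_apply_of_ne {c : Sigma A} {n j : ℕ} (F : List (Sigma A) → M) {l : List (Sigma A)}
    (h : l.length ≠ n) : insOp K M c n j F l = 0 := if_neg h

theorem symOp_swapOp [CharZero K] {n i : ℕ} (hi : i < n - 1) (F : List (Sigma A) → M) :
    symOp K M n (swapOp K M n i F) = symOp K M n F :=
  DFunLike.congr_fun ((isCoxeterA_swapOp n).symmetrizer_mul K i hi) F

/-- An exchange that involves `c` only moves `c` by one place, without sign since its degree is
zero. Any other exchange is an exchange of the remaining `n` letters, which the outer symmetrization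
absorbs. -/
theorem exists_symOp_insOp_swapOp [CharZero K] {c : Sigma A} (hc : c.1 = 0) {n i j : ℕ}
    (hi : i < n) (hj : j ≤ n) : ∃ j' ≤ n, ∀ F : List (Sigma A) → M,
      symOp K M n (insOp K M c n j (swapOp K M (n + 1) i F)) =
        symOp K M n (insOp K M c n j' F) := by
  rcases (show i + 2 ≤ j ∨ i + 1 = j ∨ i = j ∨ j < i by omega) with h | rfl | rfl | h
  · refine ⟨j, hj, fun F => ?_⟩
    rw [← symOp_swapOp (i := i) (by omega) (insOp K M c n j F)]
    congr 1
    ext l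
    by_cases hl : l.length = n
    · rw [insOp_apply _ hl, swapOp_apply _ (by simpa using hl), swapOp_apply _ hl,
        insOp_apply _ (by simpa using hl), (swap_insAt_of_add_two_le c h (by omega)).1,
        (swap_insAt_of_add_two_le c h (by omega)).2]
    · rw [insOp_apply_of_ne _ hl, swapOp_apply_of_ne _ hl, insOp_apply_of_ne _ hl]
  · refine ⟨i, hi.le, fun F => ?_⟩
    congr 1
    ext l
    by_cases hl : l.length = n
    · obtain ⟨-, h1, -, h2⟩ := swap_insAt_self hc (j := i) (l := l) (by omega)
      rw [insOp_apply _ hl, swapOp_apply _ (by simpa using hl), insOp_apply _ hl, h1, h2, one_smul]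
    · rw [insOp_apply_of_ne _ hl, insOp_apply_of_ne _ hl]
  · refine ⟨i + 1, hi, fun F => ?_⟩
    congr 1
    ext l
    by_cases hl : l.length = n
    · obtain ⟨h1, -, h2, -⟩ := swap_insAt_self hc (j := i) (l := l) (by omega)
      rw [insOp_apply _ hl, swapOp_apply _ (by simpa using hl), insOp_apply _ hl, h1, h2, one_smul]
    · rw [insOp_apply_of_ne _ hl, insOp_apply_of_ne _ hl]
  · obtain ⟨i, rfl⟩ := Nat.exists_eq_add_of_le' (show 1 ≤ i by omega)
    refine ⟨j, hj, fun F => ?_⟩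
    rw [← symOp_swapOp (i := i) (by omega) (insOp K M c n j F)]
    congr 1
    ext l
    by_cases hl : l.length = n
    · rw [insOp_apply _ hl, swapOp_apply _ (by simpa using hl), swapOp_apply _ hl,
        insOp_apply _ (by simpa using hl), (swap_insAt_of_lt c (by omega) (by omega)).1,
        (swap_insAt_of_lt c (by omega) (by omega)).2]
    · rw [insOp_apply_of_ne _ hl, swapOp_apply_of_ne _ hl, insOp_apply_of_ne _ hl]

/-- Put `c` last, then symmetrize the other letters. On functions for which the result does not
depend on the place of `c`, this operation is invariant under all exchanges, so it cannot tell `F`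
from its full symmetrization. On the full symmetrization its second stage does nothing. -/
theorem symFun_append_singleton [CharZero K] {c : Sigma A} (hc : c.1 = 0)
    {F : List (Sigma A) → M} (hF : ∀ p q, F (p ++ c :: q) = F (p ++ q ++ [c]))
    (l : List (Sigma A)) :
    symFun K F (l ++ [c]) = symFun K (fun l => F (l ++ [c])) l := by
  generalize hn : l.length = n
  -- Independence of the place of `c` is required only after symmetrizing the other letters; in this
  -- weak form it is stable under exchanges.
  let p : Submodule K (List (Sigma A) → M) :=
    { carrier := {F | ∀ j ≤ n, symOp K M n (insOp K M c n j F) = symOp K M n (insOp K M c n n F)}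
      zero_mem' := fun _ _ => by simp
      add_mem' := fun {F G} h h' j hj => by rw [map_add, map_add, h j hj, h' j hj, map_add, map_add]
      smul_mem' := fun r F h j hj => by
        rw [map_smul, map_smul, map_smul, map_smul, h j hj] }
  have hp : ∀ i, i < n → ∀ y ∈ p, swapOp K M (n + 1) i y ∈ p ∧
      symOp K M n (insOp K M c n n (swapOp K M (n + 1) i y)) =
        symOp K M n (insOp K M c n n y) := by
    intro i hi y hy
    have key : ∀ j ≤ n, symOp K M n (insOp K M c n j (swapOp K M (n + 1) i y)) =
        symOp K M n (insOp K M c n n y) := by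
      intro j hj
      obtain ⟨j', hj', h⟩ := exists_symOp_insOp_swapOp (K := K) (M := M) hc hi hj
      rw [h y, hy j' hj']
    exact ⟨fun j hj => by rw [key j hj, key n le_rfl], key n le_rfl⟩
  have hFp : F ∈ p := by
    intro j hj
    congr 1
    ext l
    by_cases hl : l.length = n
    · rw [insOp_apply _ hl, insOp_apply _ hl, ← hl, insAt_length]
      obtain ⟨p, q, h, rfl⟩ := exists_insAt_eq c j l
      rw [h, hF]
    · rw [insOp_apply_of_ne _ hl, insOp_apply_of_ne _ hl]
  have h1 := map_symmetrizer_of_invariant (symOp K M n ∘ₗ insOp K M c n n) p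
    (fun i hi y hy => (hp i hi y hy).1) (fun i hi y hy => (hp i hi y hy).2) hFp
  have h2 : symOp K M n (insOp K M c n n (symOp K M (n + 1) F)) =
      insOp K M c n n (symOp K M (n + 1) F) := by
    refine symmetrizer_apply_of_fixed fun i hi => ?_
    ext l
    by_cases hl : l.length = n
    · have h := congrFun (swapOp_symOp (K := K) (n := n + 1) (i := i) (by omega) F) (l ++ [c])
      rw [swapOp_apply _ (by simpa using hl), ← insAt_length,
        (swap_insAt_of_add_two_le c (by omega) le_rfl).1,
        (swap_insAt_of_add_two_le c (by omega) le_rfl).2, hl] at h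
      rw [swapOp_apply _ hl, insOp_apply _ (by simpa using hl), insOp_apply _ hl, h]
    · rw [swapOp_apply_of_ne _ hl]
  have h3 := congrFun (h2.symm.trans h1) l
  rw [insOp_apply _ hn] at h3
  nth_rw 2 [← hn] at h3
  rw [insAt_length] at h3
  rw [symFun, symFun, List.length_append, hn, List.length_singleton, h3]
  refine symOp_congr (fun l' hl' => ?_) hn
  rw [insOp_apply _ hl', ← hl', insAt_length]

end Central

end Words

/-! ### Multilinear functions of words -/

section Multilinear

variable {A : ℤ → Type v}

/-- The degree of a word. -/
def wordDeg (l : List (Sigma A)) : ℤ := (l.map Sigma.fst).sum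

theorem wordDeg_swapAt (i : ℕ) (l : List (Sigma A)) : wordDeg (swapAt i l) = wordDeg l := by
  induction i generalizing l with
  | zero =>
    rcases l with _ | ⟨a, _ | ⟨b, l⟩⟩
    · rfl
    · rfl
    · simp [swapAt, wordDeg, add_left_comm]
  | succ i ih =>
    rcases l with _ | ⟨a, l⟩
    · rfl
    · simpa [swapAt, wordDeg] using ih l

/-- The new place of a letter and the sign depend on its degree but not on its vector. This is why
exchanges preserve multilinearity. -/
theorem exists_swapAt_append (i : ℕ) (p q : List (Sigma A)) (k : ℤ) :
    ∃ p' q' s, ∀ x : A k, swapAt i (p ++ ⟨k, x⟩ :: q) = p' ++ ⟨k, x⟩ :: q' ∧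
      swapSign i (p ++ ⟨k, x⟩ :: q) = s := by
  induction i generalizing p with
  | zero =>
    rcases p with _ | ⟨a, _ | ⟨b, p⟩⟩
    · rcases q with _ | ⟨c, q⟩
      · exact ⟨[], [], 1, fun x => ⟨rfl, rfl⟩⟩
      · exact ⟨[c], q, (k * c.1).negOnePow, fun x => ⟨rfl, rfl⟩⟩
    · exact ⟨[], a :: q, (a.1 * k).negOnePow, fun x => ⟨rfl, rfl⟩⟩
    · exact ⟨b :: a :: p, q, _, fun x => ⟨rfl, rfl⟩⟩
  | succ i ih =>
    rcases p with _ | ⟨a, p⟩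
    · exact ⟨[], swapAt i q, swapSign i q, fun x => ⟨rfl, rfl⟩⟩
    · obtain ⟨p', q', s, h⟩ := ih p
      exact ⟨a :: p', q', s, fun x => ⟨by simp [swapAt, (h x).1], by simp [swapSign, (h x).2]⟩⟩

variable {K : Type u} [Field K] [∀ i, AddCommGroup (A i)] [∀ i, Module K (A i)]
  {M : Type*} [AddCommGroup M] [Module K M]

/-- The functions of words that are linear in each letter and send a word of degree `n` into
`D n`. -/
def multilinearFun (A : ℤ → Type v) [∀ i, AddCommGroup (A i)] [∀ i, Module K (A i)]
    (D : ℤ → Submodule K M) : Submodule K (List (Sigma A) → M) where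
  carrier := {F | (∀ p q i, ∀ a b : A i,
      F (p ++ ⟨i, a + b⟩ :: q) = F (p ++ ⟨i, a⟩ :: q) + F (p ++ ⟨i, b⟩ :: q)) ∧
    (∀ p q i, ∀ (c : K) (a : A i), F (p ++ ⟨i, c • a⟩ :: q) = c • F (p ++ ⟨i, a⟩ :: q)) ∧
    ∀ l, F l ∈ D (wordDeg l)}
  zero_mem' := ⟨fun _ _ _ _ _ => (add_zero _).symm, fun _ _ _ _ _ => (smul_zero _).symm,
    fun _ => zero_mem _⟩
  add_mem' {F G} hF hG := ⟨fun p q i a b => by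
      simp only [Pi.add_apply, hF.1, hG.1]
      abel, fun p q i c a => by simp only [Pi.add_apply, hF.2.1, hG.2.1, smul_add],
    fun l => add_mem (hF.2.2 l) (hG.2.2 l)⟩
  smul_mem' r F hF := ⟨fun p q i a b => by simp only [Pi.smul_apply, hF.1, smul_add],
    fun p q i c a => by simp only [Pi.smul_apply, hF.2.1, smul_comm r],
    fun l => Submodule.smul_mem _ _ (hF.2.2 l)⟩

theorem units_smul_mem (p : Submodule K M) (s : ℤˣ) {x : M} (hx : x ∈ p) : s • x ∈ p := by
  rw [Units.smul_def]
  exact zsmul_mem hx _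

theorem swapOp_mem_multilinearFun {D : ℤ → Submodule K M} {F : List (Sigma A) → M}
    (hF : F ∈ multilinearFun A D) (n i : ℕ) : swapOp K M n i F ∈ multilinearFun A D := by
  refine ⟨fun p q k a b => ?_, fun p q k c a => ?_, fun l => ?_⟩
  · obtain ⟨p', q', s, h⟩ := exists_swapAt_append i p q k
    by_cases hn : p.length + (q.length + 1) = n
    · rw [swapOp_apply _ (by simpa using hn), swapOp_apply _ (by simpa using hn),
        swapOp_apply _ (by simpa using hn), (h _).1, (h _).2, (h _).1, (h _).2, (h _).1, (h _).2,
        hF.1, smul_add]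
    · rw [swapOp_apply_of_ne _ (by simpa using hn), swapOp_apply_of_ne _ (by simpa using hn),
        swapOp_apply_of_ne _ (by simpa using hn), hF.1]
  · obtain ⟨p', q', s, h⟩ := exists_swapAt_append i p q k
    by_cases hn : p.length + (q.length + 1) = n
    · rw [swapOp_apply _ (by simpa using hn), swapOp_apply _ (by simpa using hn),
        (h _).1, (h _).2, (h _).1, (h _).2, hF.2.1, smul_comm]
    · rw [swapOp_apply_of_ne _ (by simpa using hn), swapOp_apply_of_ne _ (by simpa using hn),
        hF.2.1]
  · by_cases hn : l.length = n
    · rw [swapOp_apply _ hn, ← wordDeg_swapAt i l]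
      exact units_smul_mem _ _ (hF.2.2 _)
    · rw [swapOp_apply_of_ne _ hn]
      exact hF.2.2 l

/-- A function of words that is, in each length, given by a multilinear function is multilinear. -/
theorem diag_mem_multilinearFun {D : ℤ → Submodule K M} {F : ℕ → List (Sigma A) → M}
    (hF : ∀ n, F n ∈ multilinearFun A D) : (fun l => F l.length l) ∈ multilinearFun A D := by
  refine ⟨fun p q k a b => ?_, fun p q k c a => ?_, fun l => (hF _).2.2 l⟩
  · simp only [List.length_append, List.length_cons, (hF _).1]
  · simp only [List.length_append, List.length_cons, (hF _).2.1]

theorem symFun_mem_multilinearFun {D : ℤ → Submodule K M} {F : List (Sigma A) → M}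
    (hF : F ∈ multilinearFun A D) : symFun K F ∈ multilinearFun A D :=
  diag_mem_multilinearFun (F := fun n => symOp K M n F) fun n =>
    symmetrizer_mem _ (fun i _ _ h => swapOp_mem_multilinearFun h n i) hF

theorem multilinearFun_zero {D : ℤ → Submodule K M} {F : List (Sigma A) → M}
    (hF : F ∈ multilinearFun A D) (p q : List (Sigma A)) (i : ℤ) :
    F (p ++ ⟨i, 0⟩ :: q) = 0 := by
  simpa using hF.2.1 p q i 0 0

theorem multilinearFun_mono {D D' : ℤ → Submodule K M} (h : ∀ n, D n ≤ D' n) :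
    multilinearFun A D ≤ multilinearFun A D' :=
  fun _ hF => ⟨hF.1, hF.2.1, fun l => h _ (hF.2.2 l)⟩

theorem append_mem_multilinearFun {F : List (Sigma A) → M}
    (hF : F ∈ multilinearFun A (fun _ => (⊤ : Submodule K M))) (r : List (Sigma A)) :
    (fun l => F (l ++ r)) ∈ multilinearFun A (fun _ => (⊤ : Submodule K M)) :=
  ⟨fun p q i a b => by simpa using hF.1 p (q ++ r) i a b,
    fun p q i c a => by simpa using hF.2.1 p (q ++ r) i c a, fun _ => trivial⟩

end Multilinear

/-! ### Linear maps out of the enveloping algebra as functions of words -/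

namespace ULieAlg

variable {K : Type u} [Field K] (V : ULieAlg.{u, v} K) {M : Type*} [AddCommGroup M] [Module K M]

/-- Homogeneous elements of `V`. -/
abbrev Letter : Type v := Σ i : ℤ, V.X.X i

/-- The bracket of homogeneous elements. -/
def brk (a b : V.Letter) : V.Letter := ⟨a.1 + b.1, V.bracket rfl a.2 b.2⟩

/-- The unit of `V` as a homogeneous element. -/
def unit : V.Letter := ⟨0, V.one⟩

/-- The product in the enveloping algebra of the letters of a word. -/
noncomputable def word (l : List V.Letter) : V.Env := (l.map fun p => V.gen p.1 p.2).prod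

@[simp] theorem word_nil : V.word [] = 1 := rfl

@[simp] theorem word_cons (a : V.Letter) (l : List V.Letter) :
    V.word (a :: l) = V.gen a.1 a.2 * V.word l := by simp [word]

@[simp] theorem word_append (l m : List V.Letter) : V.word (l ++ m) = V.word l * V.word m := by
  simp [word]

theorem word_mem (l : List V.Letter) : V.word l ∈ V.envDeg (wordDeg l) :=
  Submodule.subset_span ⟨l, rfl, rfl⟩

/-- Functions of words that respect the commutation relation of the enveloping algebra. -/
def IsLieFun (F : List V.Letter → M) : Prop :=
  ∀ p a b q, F (p ++ a :: b :: q) =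
    (a.1 * b.1).negOnePow • F (p ++ b :: a :: q) + F (p ++ V.brk a b :: q)

/-- Functions of words that do not change when a letter equal to the unit is left out. -/
def IsUnitalFun (F : List V.Letter → M) : Prop := ∀ p q, F (p ++ V.unit :: q) = F (p ++ q)

theorem word_mem_multilinearFun : V.word ∈ multilinearFun (fun i => V.X.X i) V.envDeg :=
  ⟨fun p q i a b => by simp [mul_add, add_mul], fun p q i c a => by simp, V.word_mem⟩

theorem word_isLieFun : V.IsLieFun V.word := by
  intro p a b q
  have h := V.gen_comm (show a.1 + b.1 = a.1 + b.1 from rfl) a.2 b.2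
  rw [sub_eq_iff_eq_add] at h
  simp only [word_append, word_cons, brk]
  rw [← _root_.mul_assoc (V.gen a.1 a.2), h]
  simp only [add_mul, mul_add, Units.smul_def, smul_mul_assoc, mul_smul_comm, _root_.mul_assoc]
  abel

theorem word_isUnitalFun : V.IsUnitalFun V.word := by
  intro p q
  simp [unit, V.gen_one]

theorem env_linearMap_ext {φ ψ : V.Env →ₗ[K] M} (h : ∀ l, φ (V.word l) = ψ (V.word l)) :
    φ = ψ := by
  have key : ∀ x : V.Env, ∀ l, φ (V.word l * x) = ψ (V.word l * x) := by
    intro x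
    induction x using V.env_induction with
    | one => simpa using h
    | gen_mul i a x hx =>
      intro l
      have h' := hx (l ++ [⟨i, a⟩])
      rw [word_append, word_cons, word_nil, _root_.mul_one, _root_.mul_assoc] at h'
      exact h'
    | add x y hx hy => intro l; rw [mul_add, map_add, map_add, hx, hy]
    | smul c x hx => intro l; rw [mul_smul_comm, map_smul, map_smul, hx]
  ext x
  simpa using key x []

variable (M) in
/-- The multilinear functions of words that come from linear maps out of the enveloping algebra. -/
def envFun : Submodule K (List V.Letter → M) where
  carrier := {F | F ∈ multilinearFun (fun i => V.X.X i) (fun _ => (⊤ : Submodule K M)) ∧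
    V.IsLieFun F ∧ V.IsUnitalFun F}
  zero_mem' := ⟨zero_mem _, fun _ _ _ _ => by simp, fun _ _ => rfl⟩
  add_mem' {F G} hF hG := ⟨add_mem hF.1 hG.1, fun p a b q => by
      simp only [Pi.add_apply, hF.2.1 p a b q, hG.2.1 p a b q, smul_add]
      abel, fun p q => by simp only [Pi.add_apply, hF.2.2 p q, hG.2.2 p q]⟩
  smul_mem' r F hF := ⟨Submodule.smul_mem _ _ hF.1, fun p a b q => by
      simp only [Pi.smul_apply, hF.2.1 p a b q, smul_add, smul_comm r],
    fun p q => by simp only [Pi.smul_apply, hF.2.2 p q]⟩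

/-- The operator of appending a homogeneous element to the argument. -/
def appendOp (i : ℤ) : V.X.X i →ₗ[K] Module.End K (V.envFun M) where
  toFun a :=
    { toFun := fun F => ⟨fun l => F.1 (l ++ [⟨i, a⟩]), append_mem_multilinearFun F.2.1 _,
        fun p b c q => by simpa using F.2.2.1 p b c (q ++ [⟨i, a⟩]),
        fun p q => by simpa using F.2.2.2 p (q ++ [⟨i, a⟩])⟩
      map_add' := fun _ _ => rfl
      map_smul' := fun _ _ => rfl }
  map_add' a b := LinearMap.ext fun F => Subtype.ext <| funext fun l => F.2.1.1 l [] i a b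
  map_smul' c a := LinearMap.ext fun F => Subtype.ext <| funext fun l => F.2.1.2.1 l [] i c a

theorem appendOp_apply {i : ℤ} (a : V.X.X i) (F : V.envFun M) (l : List V.Letter) :
    (V.appendOp i a F).1 l = F.1 (l ++ [⟨i, a⟩]) := rfl

/-- The product `appendOp a * appendOp b` appends `a` first and then `b`, so the order of letters
agrees with that of the enveloping algebra and no opposite algebra appears. -/
theorem appendOp_comm {i j k : ℤ} (h : i + j = k) (a : V.X.X i) (b : V.X.X j) :
    V.appendOp (M := M) i a * V.appendOp j b -
      (i * j).negOnePow • (V.appendOp j b * V.appendOp i a) = V.appendOp k (V.bracket h a b) := by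
  subst h
  refine LinearMap.ext fun F => Subtype.ext <| funext fun l => ?_
  have h := F.2.2.1 l ⟨i, a⟩ ⟨j, b⟩ []
  rw [← sub_eq_iff_eq_add'] at h
  simpa [appendOp_apply, Units.smul_def, brk] using h

theorem appendOp_one : V.appendOp (M := M) 0 V.one = 1 :=
  LinearMap.ext fun F => Subtype.ext <| funext fun l =>
    (F.2.2.2 l []).trans (congrArg F.1 (List.append_nil l))

variable (M) in
/-- The action of the enveloping algebra on functions of words. -/
noncomputable def envFunAction : V.Env →ₐ[K] Module.End K (V.envFun M) :=
  V.envLift (B := Module.End K (V.envFun M)) V.appendOp V.appendOp_comm V.appendOp_one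

theorem envFunAction_gen (i : ℤ) (a : V.X.X i) :
    V.envFunAction M (V.gen i a) = V.appendOp i a := by
  rw [envFunAction, envLift_gen]

theorem envFunAction_word (F : V.envFun M) (l m : List V.Letter) :
    (V.envFunAction M (V.word l) F).1 m = F.1 (m ++ l) := by
  induction l generalizing m with
  | nil => simp
  | cons a l ih =>
    rw [word_cons, map_mul, Module.End.mul_apply, envFunAction_gen, appendOp_apply, ih]
    simp

/-- A multilinear function of words that respects the relations extends to the enveloping
algebra. -/
theorem exists_env_linearMap {F : List V.Letter → M} (hF : F ∈ V.envFun M) :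
    ∃ φ : V.Env →ₗ[K] M, ∀ l, φ (V.word l) = F l := by
  -- The universal property concerns algebra maps, hence the detour through an action: `φ x` is the
  -- value at the empty word of `x` acting on `F`.
  refine ⟨(LinearMap.proj ([] : List V.Letter) ∘ₗ (V.envFun M).subtype) ∘ₗ
    (LinearMap.applyₗ (⟨F, hF⟩ : V.envFun M)) ∘ₗ (V.envFunAction M).toLinearMap, fun l => ?_⟩
  simpa using V.envFunAction_word ⟨F, hF⟩ l []

theorem map_envDeg_le {φ : V.Env →ₗ[K] M} {D : ℤ → Submodule K M}
    (h : ∀ l, φ (V.word l) ∈ D (wordDeg l)) {n : ℤ} {x : V.Env} (hx : x ∈ V.envDeg n) :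
    φ x ∈ D n := by
  induction hx using Submodule.span_induction with
  | mem x hx =>
    obtain ⟨l, rfl, rfl⟩ := hx
    exact h l
  | zero => simp
  | add x y _ _ hx hy => rw [map_add]; exact add_mem hx hy
  | smul c x _ hx => rw [map_smul]; exact Submodule.smul_mem _ _ hx

end ULieAlg

/-! ### Exchanges corrected by brackets, and their Coxeter relations -/

section Uniqueness

variable {A : ℤ → Type v} {K : Type u} [Field K] {M : Type*} [AddCommGroup M] [Module K M]

theorem swapOp_eq {n i : ℕ} (F : List (Sigma A) → M) {l p q : List (Sigma A)} {a b : Sigma A}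
    (hl : l = p ++ a :: b :: q) (hi : i = p.length) (hn : p.length + q.length + 2 = n) :
    swapOp K M n i F l = (a.1 * b.1).negOnePow • F (p ++ b :: a :: q) := by
  subst hl hi
  exact swapOp_append F a b hn

theorem negOnePow_mul_self_smul (i : ℤ) (x : M) : i.negOnePow • i.negOnePow • x = x := by
  rw [smul_smul, ← Int.negOnePow_add, Int.negOnePow_even _ ⟨i, rfl⟩, one_smul]

theorem exists_slot_linearMap [∀ i, AddCommGroup (A i)] [∀ i, Module K (A i)]
    {D : ℤ → Submodule K M} {F : List (Sigma A) → M}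
    (hF : F ∈ multilinearFun A D) (p q : List (Sigma A)) (i : ℤ) :
    ∃ g : A i →ₗ[K] M, ∀ x, F (p ++ ⟨i, x⟩ :: q) = g x :=
  ⟨{ toFun := fun x => F (p ++ ⟨i, x⟩ :: q)
     map_add' := hF.1 p q i
     map_smul' := hF.2.1 p q i }, fun _ => rfl⟩

end Uniqueness

namespace ULieAlg

variable {K : Type u} [Field K] (V : ULieAlg.{u, v} K) {M : Type*} [AddCommGroup M]

theorem brk_eq {a b : V.Letter} {k : ℤ} (h : a.1 + b.1 = k) :
    V.brk a b = ⟨k, V.bracket h a.2 b.2⟩ := by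
  subst h
  rfl

/-- Replace the letters in positions `i` and `i + 1` by their bracket. -/
def brkAt : ℕ → List V.Letter → List V.Letter
  | 0, a :: b :: l => V.brk a b :: l
  | i + 1, a :: l => a :: brkAt i l
  | _, l => l

theorem brkAt_append (p q : List V.Letter) (a b : V.Letter) :
    V.brkAt p.length (p ++ a :: b :: q) = p ++ V.brk a b :: q := by
  induction p with
  | nil => rfl
  | cons c p ih => simp [brkAt, ih]

theorem wordDeg_brkAt (i : ℕ) (l : List V.Letter) : wordDeg (V.brkAt i l) = wordDeg l := by
  induction i generalizing l with
  | zero =>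
    rcases l with _ | ⟨a, _ | ⟨b, l⟩⟩
    · rfl
    · rfl
    · simp [brkAt, wordDeg, brk, add_assoc]
  | succ i ih =>
    rcases l with _ | ⟨a, l⟩
    · rfl
    · simpa [brkAt, wordDeg] using ih l

/-- Whether or not the letter takes part in the bracket, it enters the new word through a linear map
in a single place. Multilinearity of `brkFun` follows. -/
theorem exists_brkAt_append (i : ℕ) (p q : List V.Letter) (k : ℤ) :
    ∃ p' q' k', ∃ g : V.X.X k →ₗ[K] V.X.X k',
      ∀ x, V.brkAt i (p ++ ⟨k, x⟩ :: q) = p' ++ ⟨k', g x⟩ :: q' := by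
  induction i generalizing p with
  | zero =>
    rcases p with _ | ⟨a, _ | ⟨b, p⟩⟩
    · rcases q with _ | ⟨c, q⟩
      · exact ⟨[], [], k, LinearMap.id, fun x => rfl⟩
      · exact ⟨[], q, k + c.1, (V.bracket rfl).flip c.2, fun x => rfl⟩
    · exact ⟨[], q, a.1 + k, V.bracket rfl a.2, fun x => rfl⟩
    · exact ⟨V.brk a b :: p, q, k, LinearMap.id, fun x => rfl⟩
  | succ i ih =>
    rcases p with _ | ⟨a, p⟩
    · exact ⟨[], V.brkAt i q, k, LinearMap.id, fun x => rfl⟩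
    · obtain ⟨p', q', k', g, h⟩ := ih p
      exact ⟨a :: p', q', k', g, fun x => by simp [brkAt, h x]⟩

/-- The function of words of length `n` obtained by taking the bracket of the letters in positions
`i` and `i + 1`. -/
def brkFun (n i : ℕ) (L : List V.Letter → M) (l : List V.Letter) : M :=
  if l.length = n then L (V.brkAt i l) else 0

theorem brkFun_eq {n i : ℕ} (L : List V.Letter → M) {l p q : List V.Letter} {a b : V.Letter}
    (hl : l = p ++ a :: b :: q) (hi : i = p.length) (hn : p.length + q.length + 2 = n) :
    V.brkFun n i L l = L (p ++ V.brk a b :: q) := by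
  subst hl hi
  rw [brkFun, if_pos (by simp; omega), brkAt_append]

theorem brkFun_of_ne {n i : ℕ} (L : List V.Letter → M) {l : List V.Letter} (h : l.length ≠ n) :
    V.brkFun n i L l = 0 := if_neg h

variable [Module K M]

theorem brkFun_mem {D : ℤ → Submodule K M} {L : List V.Letter → M}
    (hL : L ∈ multilinearFun (fun i => V.X.X i) D) (n i : ℕ) :
    V.brkFun n i L ∈ multilinearFun (fun i => V.X.X i) D := by
  refine ⟨fun p q k a b => ?_, fun p q k c a => ?_, fun l => ?_⟩
  · obtain ⟨p', q', k', g, h⟩ := V.exists_brkAt_append i p q k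
    by_cases hn : p.length + (q.length + 1) = n
    · simp only [brkFun, List.length_append, List.length_cons, hn, if_true, h, map_add, hL.1]
    · simp only [brkFun, List.length_append, List.length_cons, hn, if_false, add_zero]
  · obtain ⟨p', q', k', g, h⟩ := V.exists_brkAt_append i p q k
    by_cases hn : p.length + (q.length + 1) = n
    · simp only [brkFun, List.length_append, List.length_cons, hn, if_true, h, map_smul, hL.2.1]
    · simp only [brkFun, List.length_append, List.length_cons, hn, if_false, smul_zero]
  · by_cases hn : l.length = n
    · rw [brkFun, if_pos hn, ← V.wordDeg_brkAt i l]
      exact hL.2.2 _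
    · rw [brkFun, if_neg hn]
      exact zero_mem _

/-- The condition `IsLieFun` on words of length `m`, with separate functions for the words of
length `m` and `m - 1`. -/
def IsLieFunAt (m : ℕ) (L L' : List V.Letter → M) : Prop :=
  ∀ p a b q, p.length + q.length + 2 = m → L (p ++ a :: b :: q) =
    (a.1 * b.1).negOnePow • L (p ++ b :: a :: q) + L' (p ++ V.brk a b :: q)

variable {V}

/-- Antisymmetry of the bracket. This makes the corrected exchanges involutions. -/
theorem swapOp_brkFun_self {D : ℤ → Submodule K M} {L : List V.Letter → M}
    (hL : L ∈ multilinearFun (fun i => V.X.X i) D) {n i : ℕ} (hi : i < n - 1) :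
    swapOp K M n i (V.brkFun n i L) + V.brkFun n i L = 0 := by
  ext l
  by_cases hl : l.length = n
  · obtain ⟨p, a, b, q, rfl, rfl⟩ := exists_eq_append_of_lt (i := i) (l := l) (by omega)
    have hn : p.length + q.length + 2 = n := by simp at hl; omega
    rw [Pi.add_apply, swapOp_eq _ rfl rfl hn, V.brkFun_eq L rfl rfl hn, V.brkFun_eq L rfl rfl hn]
    obtain ⟨g, hg⟩ := exists_slot_linearMap hL p q (a.1 + b.1)
    rw [V.brk_eq (a := b) (b := a) (k := a.1 + b.1) (add_comm _ _), brk, hg, hg,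
      V.antisymm rfl a.2 b.2, map_neg]
    simp [Units.smul_def]
  · rw [Pi.add_apply, swapOp_apply_of_ne _ hl, V.brkFun_of_ne L hl]
    simp

/-- The failure of each bracket term to be invariant under the other, distant exchange is the same
value of `L'`, on the word with both brackets taken. -/
theorem swapOp_brkFun_comm {L L' : List V.Letter → M} {n : ℕ} (h : V.IsLieFunAt (n - 1) L L')
    {i j : ℕ} (hij : i + 2 ≤ j) (hj : j < n - 1) :
    swapOp K M n i (V.brkFun n j L) + V.brkFun n i L =
      swapOp K M n j (V.brkFun n i L) + V.brkFun n j L := by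
  ext l
  by_cases hl : l.length = n
  · obtain ⟨p, a, b, q, rfl, rfl⟩ := exists_eq_append_of_lt (i := i) (l := l) (by omega)
    obtain ⟨q, c, d, r, hq, rfl⟩ := exists_eq_append_of_lt (i := j - p.length - 2) (l := q)
      (by simp at hl; omega)
    simp only [List.length_append, List.length_cons] at hl
    have e1 : ∀ (x y z w : V.Letter), p ++ x :: y :: (q ++ z :: w :: r) =
        (p ++ x :: y :: q) ++ z :: w :: r := by simp
    have e2 : ∀ (x z w : V.Letter), p ++ x :: (q ++ z :: w :: r) =
        (p ++ x :: q) ++ z :: w :: r := by simp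
    have e3 : ∀ (x z : V.Letter), p ++ x :: (q ++ z :: r) =
        (p ++ x :: q) ++ z :: r := by simp
    have e4 : ∀ (x y z : V.Letter), p ++ x :: y :: (q ++ z :: r) =
        (p ++ x :: y :: q) ++ z :: r := by simp
    rw [Pi.add_apply, Pi.add_apply,
      swapOp_eq _ rfl rfl (by simp; omega), V.brkFun_eq _ rfl rfl (by simp; omega),
      V.brkFun_eq _ (e1 b a c d) (by simp; omega) (by simp; omega),
      swapOp_eq _ (e1 a b c d) (by simp; omega) (by simp; omega),
      V.brkFun_eq _ (e1 a b c d) (by simp; omega) (by simp; omega), ← e1,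
      V.brkFun_eq _ rfl rfl (by simp; omega), e2, h (p ++ V.brk a b :: q) c d r (by simp; omega),
      ← e4, ← e4, h p a b (q ++ V.brk c d :: r) (by simp; omega), e3, e2, e4]
    abel
  · rw [Pi.add_apply, Pi.add_apply, swapOp_apply_of_ne _ hl, swapOp_apply_of_ne _ hl,
      V.brkFun_of_ne L hl, V.brkFun_of_ne L hl]

/-- The Jacobi identity in the form `[[a, b], c] + (-1)^{|a||b|} [b, [a, c]] = [a, [b, c]]`. -/
theorem jacobi_leibniz {D : ℤ → Submodule K M} {L : List V.Letter → M}
    (hL : L ∈ multilinearFun (fun i => V.X.X i) D) (p q : List V.Letter) (a b c : V.Letter) :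
    L (p ++ V.brk (V.brk a b) c :: q) +
        (a.1 * b.1).negOnePow • L (p ++ V.brk b (V.brk a c) :: q) =
      L (p ++ V.brk a (V.brk b c) :: q) := by
  obtain ⟨i, a⟩ := a
  obtain ⟨j, b⟩ := b
  obtain ⟨k, c⟩ := c
  obtain ⟨g, hg⟩ := exists_slot_linearMap hL p q (i + (j + k))
  have h := congrArg g (V.jacobi (ij := i + j) (jk := j + k) (ki := k + i) rfl rfl rfl
    rfl a b c)
  have E1 : V.brk (V.brk ⟨i, a⟩ ⟨j, b⟩) ⟨k, c⟩ = ⟨i + (j + k),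
      V.bracket (add_assoc i j k) (V.bracket rfl a b) c⟩ :=
    V.brk_eq (a := V.brk ⟨i, a⟩ ⟨j, b⟩) (b := ⟨k, c⟩) (add_assoc i j k)
  have E2 : V.brk ⟨j, b⟩ (V.brk ⟨i, a⟩ ⟨k, c⟩) = ⟨i + (j + k),
      V.bracket (show j + (k + i) = i + (j + k) by ring) b (V.bracket (add_comm i k) a c)⟩ := by
    rw [V.brk_eq (a := ⟨i, a⟩) (b := ⟨k, c⟩) (add_comm i k)]
    exact V.brk_eq (a := ⟨j, b⟩) (b := ⟨k + i, V.bracket (add_comm i k) a c⟩) _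
  have E3 : V.brk ⟨i, a⟩ (V.brk ⟨j, b⟩ ⟨k, c⟩) = ⟨i + (j + k),
      V.bracket rfl a (V.bracket rfl b c)⟩ := rfl
  have e1 : ((i + j) * k).negOnePow = (i * k).negOnePow * (k * j).negOnePow := by
    rw [← Int.negOnePow_add]; congr 1; ring
  rw [E1, E2, E3, hg, hg, hg, V.antisymm _ (V.bracket rfl a b) c, V.antisymm _ a c, e1]
  rw [mul_comm j i] at h
  generalize (i * k).negOnePow = s at *
  generalize (i * j).negOnePow = t at *
  generalize (k * j).negOnePow = r at *
  simp only [map_add, map_neg, map_zero, Units.smul_def, map_zsmul] at h ⊢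
  -- Once the three Koszul signs are fixed, the claim is a rearrangement of the Jacobi identity.
  rcases Int.units_eq_one_or s with rfl | rfl <;> rcases Int.units_eq_one_or t with rfl | rfl <;>
    rcases Int.units_eq_one_or r with rfl | rfl <;>
    simp only [Units.val_one, Units.val_neg, one_smul, neg_smul, mul_one, mul_neg,
      neg_neg] at h ⊢ <;> grind

/-- Each side brackets every pair among three adjacent letters once. Comparing terms with the same
pair, the relation for `L` leaves three double brackets in `L'`, which cancel by the Jacobi
identity. -/
theorem swapOp_brkFun_braid {D : ℤ → Submodule K M} {L L' : List V.Letter → M} {n : ℕ}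
    (h : V.IsLieFunAt (n - 1) L L') (hL' : L' ∈ multilinearFun (fun i => V.X.X i) D)
    {i : ℕ} (hi : i + 1 < n - 1) :
    swapOp K M n i (swapOp K M n (i + 1) (V.brkFun n i L)) +
        swapOp K M n i (V.brkFun n (i + 1) L) + V.brkFun n i L =
      swapOp K M n (i + 1) (swapOp K M n i (V.brkFun n (i + 1) L)) +
        swapOp K M n (i + 1) (V.brkFun n i L) + V.brkFun n (i + 1) L := by
  ext l
  by_cases hl : l.length = n
  · obtain ⟨p, a, b, q, rfl, rfl⟩ := exists_eq_append_of_lt (i := i) (l := l) (by omega)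
    rcases q with _ | ⟨c, q⟩
    · simp at hl; omega
    simp only [List.length_append, List.length_cons] at hl
    have e : ∀ (x y z : V.Letter), p ++ x :: y :: z :: q = (p ++ [x]) ++ y :: z :: q := by simp
    have e' : ∀ (x y : V.Letter), (p ++ [x]) ++ y :: q = p ++ x :: y :: q := by simp
    have hn1 : ∀ x : V.Letter, p.length + (x :: q).length + 2 = n := fun x => by simp; omega
    have hn2 : ∀ x : V.Letter, (p ++ [x]).length + q.length + 2 = n := fun x => by simp; omega
    have hi2 : ∀ x : V.Letter, p.length + 1 = (p ++ [x]).length := by simp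
    simp only [Pi.add_apply]
    rw [swapOp_eq _ rfl rfl (hn1 c), swapOp_eq _ (e b a c) (hi2 b) (hn2 b), ← e,
      V.brkFun_eq _ rfl rfl (hn1 a), swapOp_eq _ rfl rfl (hn1 c),
      V.brkFun_eq _ (e b a c) (hi2 b) (hn2 b), V.brkFun_eq _ rfl rfl (hn1 c),
      swapOp_eq _ (e a b c) (hi2 a) (hn2 a), ← e, swapOp_eq _ rfl rfl (hn1 b),
      V.brkFun_eq _ (e c a b) (hi2 c) (hn2 c), swapOp_eq _ (e a b c) (hi2 a) (hn2 a), ← e,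
      V.brkFun_eq _ rfl rfl (hn1 b), V.brkFun_eq _ (e a b c) (hi2 a) (hn2 a), e', e', e',
      h p (V.brk a b) c q (by omega), h p b (V.brk a c) q (by omega),
      h p a (V.brk b c) q (by omega), ← jacobi_leibniz hL' p q a b c]
    have s1 : ((V.brk a b).1 * c.1).negOnePow = (a.1 * c.1).negOnePow * (b.1 * c.1).negOnePow := by
      rw [← Int.negOnePow_add]; congr 1; simp [brk]; ring
    have s2 : (a.1 * (V.brk b c).1).negOnePow = (a.1 * b.1).negOnePow * (a.1 * c.1).negOnePow := by
      rw [← Int.negOnePow_add]; congr 1; simp [brk]; ring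
    have s3 : (b.1 * (V.brk a c).1).negOnePow = (a.1 * b.1).negOnePow * (b.1 * c.1).negOnePow := by
      rw [← Int.negOnePow_add]; congr 1; simp [brk]; ring
    have hs (x : M) : (a.1 * b.1).negOnePow • ((a.1 * b.1).negOnePow * (b.1 * c.1).negOnePow) • x =
        (b.1 * c.1).negOnePow • x := by
      rw [← smul_smul, negOnePow_mul_self_smul]
    rw [s1, s2, s3, smul_add, hs, smul_smul, smul_smul, mul_comm (b.1 * c.1).negOnePow]
    abel
  · simp only [Pi.add_apply, swapOp_apply_of_ne _ hl, V.brkFun_of_ne L hl]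

variable (V) in
/-- The affine operators whose fixed points are the solutions of `IsLieFunAt`, made linear by an
additional coordinate. -/
def affOp (n : ℕ) (L : List V.Letter → M) (i : ℕ) : Module.End K ((List V.Letter → M) × K) where
  toFun x := (swapOp K M n i x.1 + x.2 • V.brkFun n i L, x.2)
  map_add' x y := Prod.ext (by simp only [Prod.fst_add, Prod.snd_add, map_add]; module) rfl
  map_smul' c x := Prod.ext (by simp [smul_smul]) rfl

theorem affOp_apply (n : ℕ) (L : List V.Letter → M) (i : ℕ) (x : (List V.Letter → M) × K) :
    V.affOp n L i x = (swapOp K M n i x.1 + x.2 • V.brkFun n i L, x.2) := rfl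

/-- The linear parts satisfy the relations already. What remains is the identity between the bracket
corrections: antisymmetry for squares, the Jacobi identity for braids, and the relation in length `n
- 1` for braids and distant pairs. -/
theorem isCoxeterA_affOp {D : ℤ → Submodule K M} {L L' : List V.Letter → M} {n : ℕ}
    (h : V.IsLieFunAt (n - 1) L L') (hL : L ∈ multilinearFun (fun i => V.X.X i) D)
    (hL' : L' ∈ multilinearFun (fun i => V.X.X i) D) :
    IsCoxeterA (V.affOp (K := K) n L) (n - 1) where
  sq i hi := by
    refine LinearMap.ext fun x => Prod.ext ?_ rfl
    have h1 := DFunLike.congr_fun ((isCoxeterA_swapOp (K := K) (M := M) n).sq i hi) x.1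
    simp only [Module.End.mul_apply, Module.End.one_apply, affOp_apply, map_add, map_smul] at h1 ⊢
    rw [h1, add_assoc, ← smul_add, swapOp_brkFun_self hL hi, smul_zero, add_zero]
  braid i hi := by
    refine LinearMap.ext fun x => Prod.ext ?_ rfl
    have h1 := DFunLike.congr_fun ((isCoxeterA_swapOp (K := K) (M := M) n).braid i hi) x.1
    simp only [Module.End.mul_apply, affOp_apply, map_add, map_smul] at h1 ⊢
    rw [h1, add_assoc, add_assoc, add_assoc, add_assoc, ← smul_add, ← smul_add, ← smul_add,
      ← smul_add, ← add_assoc, ← add_assoc, swapOp_brkFun_braid h hL' hi]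
  comm i j hij hj := by
    refine LinearMap.ext fun x => Prod.ext ?_ rfl
    have h1 := DFunLike.congr_fun ((isCoxeterA_swapOp (K := K) (M := M) n).comm i j hij hj) x.1
    simp only [Module.End.mul_apply, affOp_apply, map_add, map_smul] at h1 ⊢
    rw [h1, add_assoc, add_assoc, ← smul_add, ← smul_add, swapOp_brkFun_comm h hij hj]

end ULieAlg

/-! ### The Poincaré-Birkhoff-Witt theorem -/

namespace ULieAlg

variable {K : Type u} [Field K] {V : ULieAlg.{u, v} K} {M : Type*} [AddCommGroup M]
  [Module K M]

variable (V) in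
/-- The unital Lie algebra `V` with its bracket replaced by zero. -/
abbrev ab : ULieAlg.{u, v} K where
  X := V.X
  bracket _ := 0
  one := V.one
  d_one := V.d_one
  d_bracket := by simp
  antisymm := by simp
  jacobi := by simp
  bracket_one := by simp

theorem ab_isLieFun_iff {D : ℤ → Submodule K M} {F : List V.Letter → M}
    (hF : F ∈ multilinearFun (fun i => V.X.X i) D) : V.ab.IsLieFun F ↔ IsSymmFun F := by
  have h0 : ∀ p q (a b : V.Letter), F (p ++ V.ab.brk a b :: q) = 0 :=
    fun p q a b => multilinearFun_zero hF p q _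
  refine forall₄_congr fun p a b q => ?_
  rw [h0, add_zero]

theorem IsLieFun.comp {M' : Type*} [AddCommGroup M'] [Module K M'] {F : List V.Letter → M}
    (hF : V.IsLieFun F) (φ : M →ₗ[K] M') : V.IsLieFun (φ ∘ F) := by
  intro p a b q
  simp only [Function.comp_apply, hF p a b q, map_add, Units.smul_def, map_zsmul]

theorem brk_unit_left (a : V.Letter) : V.brk V.unit a = ⟨a.1, 0⟩ := by
  rw [V.brk_eq (a := V.unit) (b := a) (zero_add a.1)]
  congr 1
  change V.bracket _ V.one a.2 = 0
  rw [V.antisymm, V.bracket_one, smul_zero, neg_zero]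

/-- The unit has degree zero and brackets to zero, so it passes every letter without sign or
correction. -/
theorem IsLieFun.apply_unit {D : ℤ → Submodule K M} {L : List V.Letter → M} (hL : V.IsLieFun L)
    (hLD : L ∈ multilinearFun (fun i => V.X.X i) D) (p q : List V.Letter) :
    L (p ++ V.unit :: q) = L (p ++ q ++ [V.unit]) := by
  induction q generalizing p with
  | nil => simp
  | cons a q ih =>
    rw [hL p V.unit a q, brk_unit_left, multilinearFun_zero hLD, add_zero]
    have := ih (p ++ [a])
    simp only [List.append_assoc, List.cons_append, List.nil_append] at this
    rw [this]
    simp [unit]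

variable [CharZero K]

/-- The new function is the average of `σ` under the corrected exchanges. It is a fixed point of
each of them, which is the commutator relation in length `n + 1`. -/
theorem exists_isLieFunAt_succ {D : ℤ → Submodule K M} {σ L L' : List V.Letter → M}
    (hσ : IsSymmFun σ) (hσD : σ ∈ multilinearFun (fun i => V.X.X i) D) {n : ℕ}
    (h : V.IsLieFunAt n L L') (hL : L ∈ multilinearFun (fun i => V.X.X i) D)
    (hL' : L' ∈ multilinearFun (fun i => V.X.X i) D) :
    ∃ L₁ ∈ multilinearFun (fun i => V.X.X i) D, V.IsLieFunAt (n + 1) L₁ L ∧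
      symOp K M (n + 1) L₁ = σ := by
  have hcox := isCoxeterA_affOp (n := n + 1) h hL hL'
  set E := symmetrizer K (V.affOp (K := K) (n + 1) L) (n + 1 - 1) with hE
  have hfix : ∀ i, i < n + 1 - 1 → ∀ x, V.affOp (n + 1) L i (E x) = E x :=
    fun i hi x => DFunLike.congr_fun (hcox.mul_symmetrizer K i hi) x
  have hsnd : ∀ x, (E x).2 = x.2 := fun x => by
    have := map_symmetrizer (LinearMap.snd K (List V.Letter → M) K) (m := n + 1 - 1)
      (s := V.affOp (n + 1) L) (s' := fun _ => 1) (fun i _ y => rfl) x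
    rw [symmetrizer_apply_of_fixed (s := fun _ => (1 : Module.End K K)) fun i _ => rfl] at this
    exact this
  have hinl : ∀ F, E (F, 0) = (symOp K M (n + 1) F, 0) := fun F =>
    (map_symmetrizer (LinearMap.inl K (List V.Letter → M) K) (m := n + 1 - 1)
      (s := swapOp K M (n + 1)) (s' := V.affOp (n + 1) L)
      (fun i _ y => by simp [affOp_apply]) F).symm
  refine ⟨(E (σ, 1)).1, ?_, ?_, ?_⟩
  · refine (symmetrizer_mem (K := K) (s := V.affOp (n + 1) L) (m := n + 1 - 1)
      ((multilinearFun (fun i => V.X.X i) D).comap (LinearMap.fst K (List V.Letter → M) K))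
      (fun i _ y hy => ?_) (y := (σ, 1)) hσD : _)
    exact add_mem (swapOp_mem_multilinearFun hy _ _)
      (Submodule.smul_mem _ _ (V.brkFun_mem hL _ _))
  · intro p a b q hn
    have h1 := congrFun (congrArg Prod.fst (hfix p.length (by omega) (σ, 1))) (p ++ a :: b :: q)
    rw [affOp_apply, hsnd] at h1
    simp only [one_smul, Pi.add_apply] at h1
    rw [swapOp_eq _ rfl rfl hn, V.brkFun_eq L rfl rfl hn] at h1
    exact h1.symm
  -- The averaging operator `E` is idempotent and restricts to ordinary symmetrization where the
  -- extra coordinate vanishes. Hence the difference of the new function and `σ` has symmetrization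
  -- zero.
  · have h1 : E (E (σ, 1)) = E (σ, 1) := symmetrizer_apply_of_fixed fun i hi => hfix i hi _
    have h2 : E (σ, 1) = ((E (σ, 1)).1 - σ, 0) + (σ, 1) := by
      refine Prod.ext (by simp) ?_
      rw [hsnd]
      simp
    rw [h2, map_add, hinl, ← h2, add_eq_right] at h1
    have h3 := congrArg Prod.fst h1
    simp only [map_sub, Prod.fst_zero, sub_eq_zero] at h3
    rw [h3]
    exact symmetrizer_apply_of_fixed fun i hi => hσ.swapOp hi

/-- Every graded symmetric multilinear function of words is the symmetrization of a function that
respects the commutation relation of the enveloping algebra. -/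
theorem exists_isLieFun_symFun_eq {D : ℤ → Submodule K M} {σ : List V.Letter → M}
    (hσ : IsSymmFun σ) (hσD : σ ∈ multilinearFun (fun i => V.X.X i) D) :
    ∃ L ∈ multilinearFun (fun i => V.X.X i) D, V.IsLieFun L ∧ symFun K L = σ := by
  -- The recursion carries the functions for two consecutive lengths, since the Coxeter relations in
  -- length `n + 1` need the commutator relation between lengths `n` and `n - 1`. The start `(σ, σ)`
  -- is harmless: in length zero the relation is vacuous.
  let P : ℕ → (List V.Letter → M) × (List V.Letter → M) → Prop := fun n x =>
    x.1 ∈ multilinearFun (fun i => V.X.X i) D ∧ x.2 ∈ multilinearFun (fun i => V.X.X i) D ∧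
      V.IsLieFunAt n x.2 x.1 ∧ symOp K M n x.2 = σ
  have step : ∀ n x, P n x → ∃ L₁, P (n + 1) (x.2, L₁) := fun n x hx => by
    obtain ⟨L₁, h1, h2, h3⟩ := exists_isLieFunAt_succ hσ hσD hx.2.2.1 hx.2.1 hx.1
    exact ⟨L₁, hx.2.1, h1, h2, h3⟩
  choose! next hnext using step
  let S : ℕ → (List V.Letter → M) × (List V.Letter → M) :=
    Nat.rec (σ, σ) fun n x => (x.2, next n x)
  have hS : ∀ n, P n (S n) := by
    intro n
    induction n with
    | zero => exact ⟨hσD, hσD, fun p a b q h => by omega, rfl⟩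
    | succ n ih => exact hnext n _ ih
  refine ⟨fun l => (S l.length).2 l, diag_mem_multilinearFun (F := fun n => (S n).2)
    fun n => (hS n).2.1, fun p a b q => ?_, ?_⟩
  · have h := (hS (p.length + q.length + 1 + 1)).2.2.1 p a b q rfl
    have e1 : (p ++ a :: b :: q).length = p.length + q.length + 1 + 1 := by simp; omega
    have e2 : (p ++ b :: a :: q).length = p.length + q.length + 1 + 1 := by simp; omega
    have e3 : (p ++ V.brk a b :: q).length = p.length + q.length + 1 := by simp; omega
    simp only [e1, e2, e3]
    exact h
  · ext l
    rw [← (hS l.length).2.2.2]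
    exact symOp_congr (fun l' hl' => by rw [hl']) rfl

/-- A function that respects the commutation relation of the enveloping algebra is determined by
its symmetrization. -/
theorem IsLieFun.ext {L L' : List V.Letter → M} (hL : V.IsLieFun L) (hL' : V.IsLieFun L')
    (h : symFun K L = symFun K L') : L = L' := by
  have key : ∀ n, ∀ l : List V.Letter, l.length = n → L l = L' l := by
    intro n
    induction n using Nat.strong_induction_on with
    | _ n ih =>
      intro l hl
      -- The bracket terms live on shorter words, where `L` and `L'` agree, so they cancel and `G`
      -- is symmetric. It is then its own symmetrization, which vanishes on words of length `n`.
      let G : List V.Letter → M := fun l => if l.length = n then L l - L' l else 0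
      have hG : symOp K M n G = G := by
        refine symmetrizer_apply_of_fixed fun i hi => ?_
        ext l'
        by_cases hl' : l'.length = n
        · obtain ⟨p, a, b, q, rfl, rfl⟩ := exists_eq_append_of_lt (i := i) (l := l') (by omega)
          have hn : p.length + q.length + 2 = n := by simp at hl'; omega
          have hb : (p ++ b :: a :: q).length = n := by simp; omega
          have hlow := ih (p.length + q.length + 1) (by omega) (p ++ V.brk a b :: q)
            (by simp; omega)
          rw [swapOp_eq _ rfl rfl hn]
          simp only [G, hl', hb, if_true, hL p a b q, hL' p a b q, hlow, smul_sub]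
          abel
        · exact swapOp_apply_of_ne _ hl'
      have h1 : symOp K M n G l = symOp K M n (L - L') l :=
        symOp_congr (fun l' hl' => if_pos hl') hl
      have h2 := congrFun h l
      rw [symFun, symFun, hl] at h2
      rw [hG, map_sub, Pi.sub_apply, h2, sub_self] at h1
      rw [← sub_eq_zero, ← h1]
      exact (if_pos hl).symm
  ext l
  exact key _ l rfl

/-- Appending the unit to the argument gives another function with the commutator relation. Its
symmetrization is that of `L`, because the unit can be moved freely, so `IsLieFun.ext` identifies
the two. -/
theorem IsLieFun.isUnitalFun {D : ℤ → Submodule K M} {L : List V.Letter → M} (hL : V.IsLieFun L)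
    (hLD : L ∈ multilinearFun (fun i => V.X.X i) D) (h : V.IsUnitalFun (symFun K L)) :
    V.IsUnitalFun L := by
  have hcent := hL.apply_unit hLD
  have hG : (fun l => L (l ++ [V.unit])) = L := by
    refine IsLieFun.ext (K := K) (fun p a b q => by simpa using hL p a b (q ++ [V.unit])) hL ?_
    ext l
    rw [← symFun_append_singleton (c := V.unit) rfl hcent]
    simpa using h l []
  intro p q
  rw [hcent, ← congrFun hG (p ++ q)]

/-- In a symmetric function the unit, of degree zero, moves to the end without sign; there
`symFun_append_singleton` removes it. -/
theorem IsUnitalFun.symFun {F : List V.Letter → M} (hF : V.IsUnitalFun F) :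
    V.IsUnitalFun (symFun K F) := by
  have hc : ∀ p q, F (p ++ V.unit :: q) = F (p ++ q ++ [V.unit]) := fun p q => by
    rw [hF, hF]; simp
  have hsymm : ∀ p q, _root_.symFun K F (p ++ V.unit :: q) =
      _root_.symFun K F (p ++ q ++ [V.unit]) := by
    intro p q
    induction q generalizing p with
    | nil => simp
    | cons a q ih =>
      rw [symFun_isSymmFun F p V.unit a q]
      have := ih (p ++ [a])
      simp only [List.append_assoc, List.cons_append, List.nil_append] at this
      rw [this]
      simp [unit]
  intro p q
  rw [hsymm, symFun_append_singleton (c := V.unit) rfl hc]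
  congr 1
  ext l
  simpa using hF l []

variable (V) in
/-- The Poincaré-Birkhoff-Witt theorem: graded symmetrization identifies the enveloping algebra of
`V` with bracket zero with the enveloping algebra of `V`. -/
theorem exists_pbw : ∃ e : V.ab.Env ≃ₗ[K] V.Env,
    (∀ l, e (V.ab.word l) = symFun K V.word l) ∧ (∀ n, ∀ x ∈ V.ab.envDeg n, e x ∈ V.envDeg n) ∧
      ∀ n, ∀ x ∈ V.envDeg n, e.symm x ∈ V.ab.envDeg n := by
  have hword : symFun K V.word ∈ multilinearFun (fun i => V.X.X i) V.envDeg :=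
    symFun_mem_multilinearFun V.word_mem_multilinearFun
  obtain ⟨β, hβ⟩ := V.ab.exists_env_linearMap (F := symFun K V.word)
    ⟨multilinearFun_mono (fun _ => le_top) hword, (ab_isLieFun_iff hword).2 (symFun_isSymmFun _),
      IsUnitalFun.symFun V.word_isUnitalFun⟩
  have hab : IsSymmFun (V.ab.word : List V.Letter → V.ab.Env) :=
    (ab_isLieFun_iff V.ab.word_mem_multilinearFun).1 V.ab.word_isLieFun
  -- The inverse comes from lifting the symmetric function `V.ab.word`; the lift `L` defines a
  -- linear map on `V.Env`.
  obtain ⟨L, hLD, hL, hsym⟩ := exists_isLieFun_symFun_eq (K := K) (V := V) hab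
    V.ab.word_mem_multilinearFun
  obtain ⟨θ, hθ⟩ := V.exists_env_linearMap (F := L) ⟨multilinearFun_mono (fun _ => le_top) hLD, hL,
    hL.isUnitalFun hLD (by rw [hsym]; exact V.ab.word_isUnitalFun)⟩
  have hθ' : θ ∘ V.word = L := funext hθ
  have h1 : θ ∘ₗ β = LinearMap.id := by
    refine V.ab.env_linearMap_ext fun l => ?_
    rw [LinearMap.comp_apply, hβ]
    change (θ ∘ symFun K V.word) l = _
    rw [← symFun_comp, hθ', hsym]
    rfl
  have h2 : β ∘ₗ θ = LinearMap.id := by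
    refine V.env_linearMap_ext fun l => ?_
    -- Both functions satisfy the commutator relation and have symmetrization `β ∘ V.ab.word`.
    refine congrFun (IsLieFun.ext (K := K) (V := V) (L := (β ∘ₗ θ) ∘ V.word) (L' := V.word)
      (V.word_isLieFun.comp _) V.word_isLieFun ?_) l
    rw [LinearMap.coe_comp, Function.comp_assoc, hθ', symFun_comp, hsym]
    exact funext hβ
  refine ⟨LinearEquiv.ofLinearMap β θ h2 h1, hβ, fun n x hx => ?_, fun n x hx => ?_⟩
  · exact V.ab.map_envDeg_le (φ := β) (fun l => by rw [hβ]; exact hword.2.2 l) hx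
  · exact V.map_envDeg_le (φ := θ) (fun l => by rw [hθ]; exact hLD.2.2 l) hx

end ULieAlg

/-! ### Symmetrization against letterwise maps and derivations -/

section Derivation

variable {A A' : ℤ → Type v}

/-- Apply a family of maps to each letter of a word. -/
def mapWord (g : ∀ i, A i → A' i) (l : List (Sigma A)) : List (Sigma A') :=
  l.map fun a => ⟨a.1, g a.1 a.2⟩

theorem swapAt_mapWord (g : ∀ i, A i → A' i) (i : ℕ) (l : List (Sigma A)) :
    swapAt i (mapWord g l) = mapWord g (swapAt i l) ∧
      swapSign i (mapWord g l) = swapSign i l := by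
  induction i generalizing l with
  | zero =>
    rcases l with _ | ⟨a, _ | ⟨b, l⟩⟩
    · exact ⟨rfl, rfl⟩
    · exact ⟨rfl, rfl⟩
    · exact ⟨rfl, rfl⟩
  | succ i ih =>
    rcases l with _ | ⟨a, l⟩
    · exact ⟨rfl, rfl⟩
    · exact ⟨congrArg (List.cons _) (ih l).1, (ih l).2⟩

variable {K : Type u} [Field K] {M M' : Type*} [AddCommGroup M] [Module K M] [AddCommGroup M']
  [Module K M']

theorem symFun_comp_mapWord (g : ∀ i, A i → A' i) (F : List (Sigma A') → M) :
    symFun K (F ∘ mapWord g) = symFun K F ∘ mapWord g := by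
  ext l
  have h := congrFun (map_symOp (K := K) (n := l.length)
    (LinearMap.funLeft K M (mapWord g) : (List (Sigma A') → M) →ₗ[K] (List (Sigma A) → M)) ?_ F) l
  · rw [Function.comp_apply, symFun, symFun, show (mapWord g l).length = l.length by simp [mapWord]]
    exact h.symm
  · intro i _ G
    ext l'
    rw [LinearMap.funLeft_apply]
    by_cases hl : l'.length = l.length
    · rw [swapOp_apply _ hl, swapOp_apply _ (by simpa [mapWord] using hl), (swapAt_mapWord g i l').1,
        (swapAt_mapWord g i l').2]
      rfl
    · rw [swapOp_apply_of_ne _ hl, swapOp_apply_of_ne _ (by simpa [mapWord] using hl)]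
      rfl

theorem symFun_add (F G : List (Sigma A) → M) : symFun K (F + G) = symFun K F + symFun K G := by
  ext l
  simp [symFun]

variable (d : ∀ i, A i → A (i - 1))

/-- The transpose of the derivation on words that extends a map `d` of degree `-1` on letters. -/
def derivFun : (List (Sigma A) → M) → List (Sigma A) → M
  | _, [] => 0
  | F, a :: l => F (⟨a.1 - 1, d a.1 a.2⟩ :: l) + a.1.negOnePow • derivFun (fun l => F (a :: l)) l

theorem derivFun_cons (F : List (Sigma A) → M) (a : Sigma A) (l : List (Sigma A)) :
    derivFun d F (a :: l) =
      F (⟨a.1 - 1, d a.1 a.2⟩ :: l) + a.1.negOnePow • derivFun d (fun l => F (a :: l)) l := rfl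

theorem derivFun_add (F G : List (Sigma A) → M) :
    derivFun d (F + G) = derivFun d F + derivFun d G := by
  ext l
  induction l generalizing F G with
  | nil => simp [derivFun]
  | cons a l ih =>
    have := ih (fun l => F (a :: l)) (fun l => G (a :: l))
    simp only [Pi.add_apply] at this
    rw [Pi.add_apply, derivFun_cons, derivFun_cons, derivFun_cons, add_add_add_comm, ← smul_add,
      ← this]
    rfl

theorem derivFun_comp (φ : M →ₗ[K] M') (F : List (Sigma A) → M) :
    derivFun d (φ ∘ F) = φ ∘ derivFun d F := by
  ext l
  induction l generalizing F with
  | nil => simp [derivFun]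
  | cons a l ih =>
    have := ih (fun l => F (a :: l))
    rw [derivFun_cons, Function.comp_apply, Function.comp_apply, derivFun_cons, map_add,
      Units.smul_def, Units.smul_def, map_zsmul]
    exact congrArg (fun x => _ + (_ : ℤ) • x) this

theorem derivFun_units_smul (s : ℤˣ) (F : List (Sigma A) → M) (l : List (Sigma A)) :
    derivFun d (fun l => s • F l) l = s • derivFun d F l := by
  induction l generalizing F with
  | nil => simp [derivFun]
  | cons a l ih =>
    rw [derivFun_cons, derivFun_cons, ih, smul_add, smul_comm s]

theorem derivFun_congr {F G : List (Sigma A) → M} {l : List (Sigma A)}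
    (h : ∀ l' : List (Sigma A), l'.length = l.length → F l' = G l') :
    derivFun d F l = derivFun d G l := by
  induction l generalizing F G with
  | nil => rfl
  | cons a l ih =>
    rw [derivFun_cons, derivFun_cons, h _ (by simp), ih fun l' hl' => h _ (by simp [hl'])]

/-- Lowering the degree of one of two exchanged letters changes their Koszul sign by the parity of
the other, which is exactly the sign acquired when `d` passes that other letter. -/
theorem derivFun_swapAt (i : ℕ) (F : List (Sigma A) → M) (l : List (Sigma A)) :
    derivFun d (fun l => swapSign i l • F (swapAt i l)) l =
      swapSign i l • derivFun d F (swapAt i l) := by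
  induction i generalizing F l with
  | zero =>
    rcases l with _ | ⟨a, _ | ⟨b, l⟩⟩
    · simp [derivFun, swapAt]
    · simp [derivFun, swapAt, swapSign]
    · have e1 : ((a.1 - 1) * b.1).negOnePow = (a.1 * b.1).negOnePow * b.1.negOnePow := by
        rw [← Int.negOnePow_sub]; congr 1; ring
      have e2 : (a.1 * (b.1 - 1)).negOnePow = (a.1 * b.1).negOnePow * a.1.negOnePow := by
        rw [← Int.negOnePow_sub]; congr 1; ring
      simp only [derivFun_cons, swapAt, swapSign, derivFun_units_smul, e1, e2, smul_add, smul_smul]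
      have h1 : a.1.negOnePow * ((a.1 * b.1).negOnePow * a.1.negOnePow) =
          (a.1 * b.1).negOnePow := by
        rw [mul_comm, mul_assoc, ← Int.negOnePow_add a.1, Int.negOnePow_even _ ⟨a.1, rfl⟩, mul_one]
      rw [h1, show a.1.negOnePow * (b.1.negOnePow * (a.1 * b.1).negOnePow) =
        (a.1 * b.1).negOnePow * (b.1.negOnePow * a.1.negOnePow) by
          rw [mul_comm, mul_comm b.1.negOnePow, mul_assoc]]
      abel
  | succ i ih =>
    rcases l with _ | ⟨a, l⟩
    · simp [derivFun, swapAt]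
    · simp only [derivFun_cons, swapAt, swapSign, smul_add]
      rw [ih fun l => F (a :: l), smul_comm]

/-- Symmetrization commutes with derivations. -/
theorem symFun_derivFun (F : List (Sigma A) → M) :
    symFun K (derivFun d F) = derivFun d (symFun K F) := by
  let B : Module.End K (List (Sigma A) → M) :=
    { toFun := derivFun d
      map_add' := derivFun_add d
      map_smul' := fun c F => derivFun_comp d (LinearMap.lsmul K M c) F }
  ext l
  have h := congrFun (map_symOp (K := K) (n := l.length) B ?_ F) l
  · refine h.symm.trans (derivFun_congr d fun l' hl' => ?_)
    rw [symFun, hl']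
  · intro i _ G
    ext l'
    by_cases hl : l'.length = l.length
    · rw [swapOp_apply _ hl]
      refine Eq.trans ?_ (derivFun_swapAt d i G l')
      exact derivFun_congr d fun l'' hl'' => swapOp_apply _ (hl''.trans hl)
    · rw [swapOp_apply_of_ne _ hl]
      exact derivFun_congr d fun l'' hl'' => swapOp_apply_of_ne _ (by rwa [hl''])

end Derivation

/-! ### The PBW map commutes with differentials and morphisms -/

namespace ULieAlg

variable {K : Type u} [Field K] {V W : ULieAlg.{u, v} K} {M : Type*} [AddCommGroup M] [Module K M]

variable (V) in
/-- The differential of `V` as a family of maps. -/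
def dLetter (i : ℤ) (a : V.X.X i) : V.X.X (i - 1) := (V.X.d i (i - 1)).hom a

/-- A general `φ` is needed for the induction: removing the first letter replaces `φ` by its
composite with left multiplication by that letter. -/
theorem envD_word (φ : V.Env →ₗ[K] M) (l : List V.Letter) :
    φ (V.envD (V.word l)) = derivFun V.dLetter (φ ∘ V.word) l := by
  induction l generalizing φ with
  | nil => simp [derivFun, V.envD_one]
  | cons a l ih =>
    rw [word_cons, envD_gen_mul, V.envD_gen (i' := a.1 - 1) (by omega), map_add, derivFun_cons,
      Units.smul_def, map_zsmul, Units.smul_def]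
    have := ih (φ ∘ₗ LinearMap.mulLeft K (V.gen a.1 a.2))
    rw [LinearMap.comp_apply, LinearMap.mulLeft_apply] at this
    rw [this]
    simp only [Function.comp_apply, word_cons, dLetter, Function.comp_def, LinearMap.comp_apply,
      LinearMap.mulLeft_apply]

theorem envD_comp_word : V.envD ∘ V.word = derivFun V.dLetter V.word :=
  funext fun l => envD_word LinearMap.id l

/-- The morphism of unital Lie algebras with zero bracket given by a chain map that preserves the
unit. -/
def abHom (g : V.X ⟶ W.X) (hg : (g.f 0).hom V.one = W.one) : V.ab ⟶ W.ab where
  hom := g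
  map_bracket _ _ _ := by simp
  map_one := hg

theorem envMap_word (f : V ⟶ W) (l : List V.Letter) :
    envMap f (V.word l) = W.word (mapWord (fun i a => (f.hom.f i).hom a) l) := by
  induction l with
  | nil => simp [mapWord]
  | cons a l ih => rw [word_cons, map_mul, ih, envMap_gen]; simp [mapWord]

/-- A linear isomorphism given by symmetrization commutes with the differentials. -/
theorem envD_pbw {e : V.ab.Env →ₗ[K] V.Env} (he : ∀ l, e (V.ab.word l) = symFun K V.word l)
    (x : V.ab.Env) : V.envD (e x) = e (V.ab.envD x) := by
  suffices h : V.envD ∘ₗ e = e ∘ₗ V.ab.envD from DFunLike.congr_fun h x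
  refine V.ab.env_linearMap_ext fun l => ?_
  rw [LinearMap.comp_apply, LinearMap.comp_apply, he, envD_word]
  have h1 : e ∘ V.ab.word = symFun K V.word := funext he
  rw [h1]
  change (V.envD ∘ symFun K V.word) l = derivFun V.dLetter (symFun K V.word) l
  rw [← symFun_comp, ← symFun_derivFun, envD_comp_word]

/-- Linear isomorphisms given by symmetrization are natural. -/
theorem envMap_pbw {e : V.ab.Env →ₗ[K] V.Env} (he : ∀ l, e (V.ab.word l) = symFun K V.word l)
    {e' : W.ab.Env →ₗ[K] W.Env} (he' : ∀ l, e' (W.ab.word l) = symFun K W.word l) (f : V ⟶ W)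
    (x : V.ab.Env) : envMap f (e x) = e' (envMap (abHom f.hom f.map_one) x) := by
  suffices h : (envMap f).toLinearMap ∘ₗ e =
      e' ∘ₗ (envMap (abHom f.hom f.map_one)).toLinearMap from DFunLike.congr_fun h x
  refine V.ab.env_linearMap_ext fun l => ?_
  rw [LinearMap.comp_apply, LinearMap.comp_apply, he, AlgHom.toLinearMap_apply,
    AlgHom.toLinearMap_apply, envMap_word, he']
  change ((envMap f).toLinearMap ∘ symFun K V.word) l = (symFun K W.word ∘ mapWord _) l
  rw [← symFun_comp, ← symFun_comp_mapWord]
  exact congrFun (congrArg (symFun K) (funext fun l => envMap_word f l)) l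

/-! ### Extending homotopies from letters to the enveloping algebra -/

section Homotopy

variable (φ : V ⟶ V) (h : ∀ i, V.X.X i →ₗ[K] V.X.X (i + 1))

/-- The homotopy on words induced by a homotopy `h` from `φ` to the identity. -/
noncomputable def homotopyFun : List V.Letter → V.Env
  | [] => 0
  | a :: l => V.gen (a.1 + 1) (h a.1 a.2) * V.word l +
      a.1.negOnePow • (V.gen a.1 ((φ.hom.f a.1).hom a.2) * homotopyFun l)

theorem homotopyFun_cons (a : V.Letter) (l : List V.Letter) :
    homotopyFun φ h (a :: l) = V.gen (a.1 + 1) (h a.1 a.2) * V.word l +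
      a.1.negOnePow • (V.gen a.1 ((φ.hom.f a.1).hom a.2) * homotopyFun φ h l) := rfl

theorem homotopyFun_mem :
    homotopyFun φ h ∈ multilinearFun (fun i => V.X.X i) fun n => V.envDeg (n + 1) := by
  have hw := V.word_mem_multilinearFun
  refine ⟨fun p q k a b => ?_, fun p q k c a => ?_, fun l => ?_⟩
  · induction p with
    | nil =>
      simp only [List.nil_append, homotopyFun_cons, map_add, add_mul, smul_add]
      abel
    | cons x p ih =>
      simp only [List.cons_append, homotopyFun_cons, ih, hw.1, mul_add, smul_add]
      abel
  · induction p with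
    | nil =>
      simp only [List.nil_append, homotopyFun_cons, map_smul, smul_add, smul_mul_assoc,
        smul_comm c]
    | cons x p ih =>
      simp only [List.cons_append, homotopyFun_cons, ih, hw.2.1, mul_smul_comm, smul_add,
        smul_comm c]
  · induction l with
    | nil => exact zero_mem _
    | cons a l ih =>
      have hdeg : wordDeg (a :: l) = a.1 + wordDeg l := rfl
      rw [homotopyFun_cons, hdeg]
      exact add_mem (V.mul_mem_envDeg (by ring) (V.gen_mem_envDeg _ _) (V.word_mem l))
        (units_smul_mem _ _ (V.mul_mem_envDeg (by ring) (V.gen_mem_envDeg _ _) ih))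

variable {φ h}

theorem homotopyFun_isUnitalFun (h1 : h 0 V.one = 0) : V.IsUnitalFun (homotopyFun φ h) := by
  intro p q
  induction p with
  | nil =>
    have h2 : (φ.hom.f 0).hom V.one = V.one := φ.map_one
    simp [homotopyFun_cons, unit, h1, h2, V.gen_one]
  | cons a p ih =>
    simp only [List.cons_append, homotopyFun_cons, ih, V.word_isUnitalFun p q]

/-- This is the usual homotopy on tensor powers, a signed sum with `φ` on the letters before the
chosen one, `h` on it and the identity after it. Stating `hh` inside the enveloping algebra avoids
identifying degrees `i - 1 + 1` and `i`. -/
theorem envD_homotopyFun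
    (hh : ∀ i (a : V.X.X i), V.gen i a - V.gen i ((φ.hom.f i).hom a) =
      V.gen i ((V.X.d (i + 1) i).hom (h i a)) + V.gen (i - 1 + 1) (h (i - 1) (V.dLetter i a)))
    (l : List V.Letter) :
    V.envD (homotopyFun φ h l) + derivFun V.dLetter (homotopyFun φ h) l =
      V.word l - envMap φ (V.word l) := by
  induction l with
  | nil => simp [homotopyFun, derivFun]
  | cons a l ih =>
    have h1 : (fun l => homotopyFun φ h (a :: l)) =
        (LinearMap.mulLeft K (V.gen (a.1 + 1) (h a.1 a.2))) ∘ V.word +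
          fun l => a.1.negOnePow • ((LinearMap.mulLeft K
            (V.gen a.1 ((φ.hom.f a.1).hom a.2))) ∘ homotopyFun φ h) l := rfl
    have hc : (V.X.d a.1 (a.1 - 1)).hom ((φ.hom.f a.1).hom a.2) =
        (φ.hom.f (a.1 - 1)).hom (V.dLetter a.1 a.2) := by
      rw [dLetter, ← LinearMap.comp_apply, ← ModuleCat.hom_comp, φ.hom.comm]
      rfl
    have e1 : (a.1 + 1).negOnePow = -a.1.negOnePow := Int.negOnePow_succ _
    have e2 : (a.1 - 1).negOnePow = -a.1.negOnePow := by rw [Int.negOnePow_sub]; simp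
    -- The right side telescopes as `(a - φ a) l + φ a (l - φ l)`; `hh` treats the first summand and
    -- the induction hypothesis the second.
    rw [derivFun_cons, h1, derivFun_add, Pi.add_apply, derivFun_units_smul, derivFun_comp,
      derivFun_comp, homotopyFun_cons, homotopyFun_cons, map_add, Units.smul_def, map_zsmul,
      envD_gen_mul, envD_gen_mul, V.envD_gen (i' := a.1) rfl,
      V.envD_gen (i' := a.1 - 1) (by omega), hc, ← envD_comp_word, word_cons, map_mul, envMap_gen,
      ← sub_add_cancel (V.gen a.1 a.2) (V.gen a.1 ((φ.hom.f a.1).hom a.2)), hh, add_mul, add_mul,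
      add_sub_assoc, ← mul_sub, ← ih]
    simp only [Function.comp_apply, LinearMap.mulLeft_apply, e1, e2, smul_add, mul_add,
      ← Units.smul_def, negOnePow_smul_smul_self, Units.neg_smul]
    abel

end Homotopy

/-- A homotopy from a unital chain map to the identity which vanishes on the unit induces a homotopy
on the enveloping algebra of the Lie algebra with zero bracket. -/
theorem exists_env_homotopy [CharZero K] (φ : V.ab ⟶ V.ab)
    (h : ∀ i, V.X.X i →ₗ[K] V.X.X (i + 1)) (h1 : h 0 V.one = 0)
    (hh : ∀ i (a : V.X.X i), V.ab.gen i a - V.ab.gen i ((φ.hom.f i).hom a) =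
      V.ab.gen i ((V.X.d (i + 1) i).hom (h i a)) +
        V.ab.gen (i - 1 + 1) (h (i - 1) (V.ab.dLetter i a))) :
    ∃ k : V.ab.Env →ₗ[K] V.ab.Env,
      (∀ n, ∀ x ∈ V.ab.envDeg n, k x ∈ V.ab.envDeg (n + 1)) ∧
      ∀ x, x - envMap φ x = V.ab.envD (k x) + k (V.ab.envD x) := by
  have hκ := homotopyFun_mem (V := V.ab) φ h
  have hmem := symFun_mem_multilinearFun hκ
  -- The function `homotopyFun` treats letters before and after `h` differently, so it need not
  -- descend to the quotient; its symmetrization does.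
  obtain ⟨k, hk⟩ := V.ab.exists_env_linearMap (F := symFun K (homotopyFun (V := V.ab) φ h))
    ⟨multilinearFun_mono (fun _ => le_top) hmem, (ab_isLieFun_iff hmem).2 (symFun_isSymmFun _),
      IsUnitalFun.symFun (homotopyFun_isUnitalFun h1)⟩
  refine ⟨k, fun n x hx => ?_, ?_⟩
  · exact V.ab.map_envDeg_le (φ := k) (D := fun n => V.ab.envDeg (n + 1))
      (fun l => by rw [hk]; exact hmem.2.2 l) hx
  · suffices H : LinearMap.id - (envMap φ).toLinearMap = V.ab.envD ∘ₗ k + k ∘ₗ V.ab.envD from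
      fun x => DFunLike.congr_fun H x
    refine V.ab.env_linearMap_ext fun l => ?_
    set ψ : V.ab.Env →ₗ[K] V.ab.Env := LinearMap.id - (envMap φ).toLinearMap with hψ
    -- Symmetrizing the homotopy identity on words costs nothing: it commutes with the
    -- differentials, and the right side is symmetric already.
    have hs : IsSymmFun (ψ ∘ V.ab.word) :=
      ((ab_isLieFun_iff V.ab.word_mem_multilinearFun).1 V.ab.word_isLieFun).comp ψ
    have hκ' : V.ab.envD ∘ homotopyFun (V := V.ab) φ h +
        derivFun V.ab.dLetter (homotopyFun (V := V.ab) φ h) = ψ ∘ V.ab.word :=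
      funext fun l => envD_homotopyFun hh l
    have hk' : k ∘ V.ab.word = symFun K (homotopyFun (V := V.ab) φ h) := funext hk
    rw [LinearMap.add_apply, LinearMap.comp_apply, LinearMap.comp_apply, envD_word, hk', hk,
      ← symFun_derivFun]
    change (ψ ∘ V.ab.word) l = (V.ab.envD ∘ symFun K (homotopyFun (V := V.ab) φ h) + _) l
    rw [← symFun_comp, ← symFun_add, hκ', hs.symFun_eq]

end ULieAlg

/-! ### Quasi-isomorphisms in terms of elements -/

section QuasiIso

variable {K : Type u} [Field K] {C D : ChainComplex (ModuleCat.{v} K) ℤ} (f : C ⟶ D)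

/-- A quasi-isomorphism is injective on homology, in terms of elements. -/
theorem QuasiIso.exists_eq_d [QuasiIso f] {i j k : ℤ} (hi : j + 1 = i) (hj : k + 1 = j) (x : C.X j)
    (hx : (C.d j k).hom x = 0) (y : D.X i) (hy : (f.f j).hom x = (D.d i j).hom y) :
    ∃ x' : C.X i, x = (C.d i j).hom x' := by
  -- The space of all pairs to which the claim applies serves as test object for the criterion by
  -- refinements; a preimage of the given pair under the refining epimorphism then yields the
  -- element.
  let P : Submodule K (C.X j × D.X i) :=
    LinearMap.ker ((C.d j k).hom ∘ₗ LinearMap.fst K _ _) ⊓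
      LinearMap.ker ((f.f j).hom ∘ₗ LinearMap.fst K _ _ - (D.d i j).hom ∘ₗ LinearMap.snd K _ _)
  have hmono : Mono (HomologicalComplex.homologyMap f j) := inferInstance
  rw [HomologicalComplex.mono_homologyMap_iff_up_to_refinements f i j k
    ((ComplexShape.down ℤ).prev_eq' hi) ((ComplexShape.down ℤ).next_eq' hj)] at hmono
  obtain ⟨A', π, hπ, x₁, h⟩ := hmono (A := ModuleCat.of K P)
    (ModuleCat.ofHom (LinearMap.fst K _ _ ∘ₗ P.subtype)) (by ext p; exact p.2.1)
    (ModuleCat.ofHom (LinearMap.snd K _ _ ∘ₗ P.subtype)) (by ext p; exact sub_eq_zero.1 p.2.2)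
  obtain ⟨a, ha⟩ := (ModuleCat.epi_iff_surjective π).1 hπ ⟨(x, y), hx, sub_eq_zero.2 hy⟩
  refine ⟨x₁.hom a, ?_⟩
  have h' : (π.hom a).1.1 = _ := DFunLike.congr_fun (congrArg ModuleCat.Hom.hom h) a
  rw [show π.hom a = _ from ha] at h'
  exact h'

/-- A quasi-isomorphism is surjective on homology, in terms of elements. -/
theorem QuasiIso.exists_eq_add_d [QuasiIso f] {i j k : ℤ} (hi : j + 1 = i) (hj : k + 1 = j)
    (y : D.X j) (hy : (D.d j k).hom y = 0) :
    ∃ (x : C.X j) (y' : D.X i), (C.d j k).hom x = 0 ∧ y = (f.f j).hom x + (D.d i j).hom y' := by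
  have hepi : Epi (HomologicalComplex.homologyMap f j) := inferInstance
  rw [HomologicalComplex.epi_homologyMap_iff_up_to_refinements f i j k
    ((ComplexShape.down ℤ).prev_eq' hi) ((ComplexShape.down ℤ).next_eq' hj)] at hepi
  obtain ⟨A', π, hπ, x, hx, y', h⟩ := hepi (A := ModuleCat.of K (LinearMap.ker (D.d j k).hom))
    (ModuleCat.ofHom (LinearMap.ker (D.d j k).hom).subtype) (by ext p; exact p.2)
  obtain ⟨a, ha⟩ := (ModuleCat.epi_iff_surjective π).1 hπ ⟨y, hy⟩
  refine ⟨x.hom a, y'.hom a, DFunLike.congr_fun (congrArg ModuleCat.Hom.hom hx) a, ?_⟩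
  have h' : (π.hom a).1 = _ := DFunLike.congr_fun (congrArg ModuleCat.Hom.hom h) a
  rw [show π.hom a = _ from ha] at h'
  exact h'

end QuasiIso

/-! ### Chain maps and homotopies from linear maps of enveloping algebras -/

namespace ULieAlg

variable {K : Type u} [Field K] {U V W : ULieAlg.{u, v} K}

/-- The chain map between enveloping algebras given by a linear map of degree zero that commutes
with the differentials. -/
noncomputable def envChainMap (φ : V.Env →ₗ[K] W.Env)
    (hdeg : ∀ n, ∀ x ∈ V.envDeg n, φ x ∈ W.envDeg n) (hd : ∀ x, W.envD (φ x) = φ (V.envD x)) :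
    V.envComplex ⟶ W.envComplex where
  f n := ModuleCat.ofHom (φ.restrict (hdeg n) : V.envDeg n →ₗ[K] W.envDeg n)
  comm' i j h := by
    ext x
    refine (W.envComplex_d_apply h _).trans (Subtype.ext ?_)
    refine (hd x.1).trans ?_
    exact (congrArg (fun y : V.envDeg j => φ y.1) (V.envComplex_d_apply h x)).symm

theorem envChainMap_comp_eq (φ : U.Env →ₗ[K] V.Env) (hφ) (hφd) (ψ : V.Env →ₗ[K] W.Env) (hψ) (hψd)
    (χ : U.Env →ₗ[K] W.Env) (hχ) (hχd) (h : ∀ x, ψ (φ x) = χ x) :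
    envChainMap φ hφ hφd ≫ envChainMap ψ hψ hψd = envChainMap χ hχ hχd := by
  ext n x
  exact Subtype.ext (h x.1)

theorem envChainMap_eq_id (φ : U.Env →ₗ[K] U.Env) (hφ) (hφd) (h : ∀ x, φ x = x) :
    envChainMap φ hφ hφd = 𝟙 _ := by
  ext n x
  exact Subtype.ext (h x.1)

/-- The components of the chain homotopy between maps of enveloping algebras given by a linear map
of degree one. -/
noncomputable def envHomotopyHom (k : V.Env →ₗ[K] W.Env)
    (hk : ∀ n, ∀ x ∈ V.envDeg n, k x ∈ W.envDeg (n + 1)) (i j : ℤ) :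
    V.envComplex.X i ⟶ W.envComplex.X j :=
  if hij : i + 1 = j then
    ModuleCat.ofHom (k.restrict (fun x hx => hij ▸ hk i x hx) : V.envDeg i →ₗ[K] W.envDeg j) else 0

theorem envHomotopyHom_apply (k : V.Env →ₗ[K] W.Env)
    (hk : ∀ n, ∀ x ∈ V.envDeg n, k x ∈ W.envDeg (n + 1)) {i j : ℤ} (hij : i + 1 = j)
    (x : V.envDeg i) :
    ((envHomotopyHom k hk i j).hom x : W.envDeg j).1 = k x.1 := by
  subst hij
  change ((if hij : i + 1 = i + 1 then ModuleCat.ofHom (k.restrict (fun x hx => hij ▸ hk i x hx) :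
    V.envDeg i →ₗ[K] W.envDeg (i + 1)) else 0 :
      ModuleCat.of K (V.envDeg i) ⟶ ModuleCat.of K (W.envDeg (i + 1))).hom x).1 = _
  rw [dif_pos rfl]
  rfl

/-- The chain homotopy between maps of enveloping algebras given by a linear map of degree one. -/
noncomputable def envHomotopy (φ : V.Env →ₗ[K] W.Env) (hφ) (hφd) (ψ : V.Env →ₗ[K] W.Env) (hψ) (hψd)
    (k : V.Env →ₗ[K] W.Env) (hk : ∀ n, ∀ x ∈ V.envDeg n, k x ∈ W.envDeg (n + 1))
    (h : ∀ x, φ x - ψ x = W.envD (k x) + k (V.envD x)) :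
    Homotopy (envChainMap φ hφ hφd) (envChainMap ψ hψ hψd) where
  hom := envHomotopyHom k hk
  zero i j hij := dif_neg hij
  comm i := by
    rw [dNext_eq (i' := i - 1) _ (show (i - 1) + 1 = i by omega), prevD_eq (j' := i + 1) _ rfl]
    ext x
    refine Subtype.ext ?_
    have e1 := V.envComplex_d_apply (show i - 1 + 1 = i by omega) x
    have e2 := envHomotopyHom_apply k hk (show i - 1 + 1 = i by omega)
      ((V.envComplex.d i (i - 1)).hom x)
    have e3 := congrArg Subtype.val (W.envComplex_d_apply (rfl : i + 1 = i + 1)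
      ((envHomotopyHom k hk i (i + 1)).hom x))
    have e4 := envHomotopyHom_apply k hk (rfl : i + 1 = i + 1) x
    rw [e1] at e2
    have e3' := e3.trans (congrArg W.envD e4)
    change φ x.1 = ((envHomotopyHom k hk (i - 1) i).hom ((V.envComplex.d i (i - 1)).hom x) :
      W.envDeg i).1 + ((W.envComplex.d (i + 1) i).hom ((envHomotopyHom k hk i (i + 1)).hom x) :
      W.envDeg i).1 + ψ x.1
    rw [e1, e2, e3', ← sub_eq_iff_eq_add, h, add_comm]

end ULieAlg

/-! ### Contracting the mapping cone relative to a marked cycle -/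

section Contraction

variable {K : Type u} [Field K]

/-- A linear section over the kernel of the second map of an exact sequence of vector spaces, with
one prescribed value. -/
theorem exists_section_of_exact {E₀ E₁ E₂ : Type*} [AddCommGroup E₀] [Module K E₀]
    [AddCommGroup E₁] [Module K E₁] [AddCommGroup E₂] [Module K E₂] (d₂ : E₂ →ₗ[K] E₁)
    (d₁ : E₁ →ₗ[K] E₀) (hd : ∀ x, d₁ (d₂ x) = 0) (hex : ∀ z, d₁ z = 0 → ∃ w, d₂ w = z) (u : E₂)
    (hu : d₂ u = 0 → u = 0) :
    ∃ σ : E₁ →ₗ[K] E₂, (∀ z, d₁ z = 0 → d₂ (σ z) = z) ∧ σ (d₂ u) = u := by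
  obtain ⟨s, hs⟩ := (d₂.codRestrict (LinearMap.ker d₁) hd).exists_rightInverse_of_surjective
    (LinearMap.range_eq_top.2 fun z => by
      obtain ⟨w, hw⟩ := hex z.1 z.2
      exact ⟨w, Subtype.ext hw⟩)
  obtain ⟨σ, hσ⟩ := s.exists_extend
  have h : ∀ z, d₁ z = 0 → d₂ (σ z) = z := fun z hz => by
    have h1 := congrArg Subtype.val (DFunLike.congr_fun hs ⟨z, hz⟩)
    rw [← hσ] at h1
    exact h1
  by_cases hv : d₂ u = 0
  · exact ⟨σ, h, by rw [hv, map_zero, hu hv]⟩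
  · obtain ⟨l, hl⟩ := not_forall.1 (mt (Module.forall_dual_apply_eq_zero_iff K (d₂ u)).1 hv)
    -- The rank-one correction takes its values in the kernel of `d₂`, so the section property
    -- survives, and it is scaled to send `d₂ u` to `u`.
    refine ⟨σ + ((l (d₂ u))⁻¹ • l).smulRight (u - σ (d₂ u)), fun z hz => ?_, ?_⟩
    · rw [LinearMap.add_apply, map_add, h z hz, LinearMap.smulRight_apply, map_smul, map_sub,
        h _ (hd u), sub_self, smul_zero, add_zero]
    · rw [LinearMap.add_apply, LinearMap.smulRight_apply, LinearMap.smul_apply, smul_eq_mul,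
        inv_mul_cancel₀ hl, one_smul, add_sub_cancel]

variable {C D : ChainComplex (ModuleCat.{v} K) ℤ} (f : C ⟶ D)

/-- The differential of the mapping cone of `f`. -/
def coneD (i j k : ℤ) : (C.X j × D.X i) →ₗ[K] (C.X k × D.X j) :=
  LinearMap.prod (-((C.d j k).hom ∘ₗ LinearMap.fst K _ _))
    ((f.f j).hom ∘ₗ LinearMap.fst K _ _ + (D.d i j).hom ∘ₗ LinearMap.snd K _ _)

theorem coneD_apply (i j k : ℤ) (x : C.X j) (y : D.X i) :
    coneD f i j k (x, y) = (-(C.d j k).hom x, (f.f j).hom x + (D.d i j).hom y) := rfl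

theorem d_hom_d_hom (C : ChainComplex (ModuleCat.{v} K) ℤ) (i j k : ℤ) (x : C.X i) :
    (C.d j k).hom ((C.d i j).hom x) = 0 := by
  rw [← LinearMap.comp_apply, ← ModuleCat.hom_comp, C.d_comp_d]
  rfl

theorem hom_d_hom (i j : ℤ) (x : C.X i) :
    (D.d i j).hom ((f.f i).hom x) = (f.f j).hom ((C.d i j).hom x) := by
  rw [← LinearMap.comp_apply, ← ModuleCat.hom_comp, f.comm]
  rfl

theorem coneD_coneD (i j k l : ℤ) (p : C.X j × D.X i) :
    coneD f j k l (coneD f i j k p) = 0 := by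
  obtain ⟨x, y⟩ := p
  simp [coneD_apply, d_hom_d_hom, hom_d_hom]

/-- The cone of a quasi-isomorphism is exact. Injectivity on homology makes `x` a boundary, and
surjectivity corrects the remaining cycle in `D`. -/
theorem exists_coneD_eq [QuasiIso f] {i j k l : ℤ} (hi : j + 1 = i) (hj : k + 1 = j) (hk : l + 1 = k)
    (p : C.X k × D.X j) (hp : coneD f j k l p = 0) : ∃ q, coneD f i j k q = p := by
  obtain ⟨x, y⟩ := p
  rw [coneD_apply, Prod.mk_eq_zero, neg_eq_zero] at hp
  obtain ⟨x₁, hx₁⟩ := QuasiIso.exists_eq_d f hj hk x hp.1 (-y)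
    (by rw [map_neg, eq_neg_iff_add_eq_zero, hp.2])
  obtain ⟨x₂, y₂, hx₂, hy₂⟩ := QuasiIso.exists_eq_add_d f hi hj ((f.f j).hom x₁ + y)
    (by rw [map_add, hom_d_hom, ← hx₁, hp.2])
  refine ⟨(x₂ - x₁, y₂), Prod.ext ?_ ?_⟩
  · simp [coneD_apply, hx₂, hx₁]
  · simp only [coneD_apply, map_sub]
    rw [sub_add_eq_add_sub, ← hy₂, add_sub_cancel_left]

/-- A quasi-isomorphism of complexes of vector spaces is a homotopy equivalence. The homotopy inverse
and the homotopies can be chosen to be compatible with a cycle which `f` does not send to zero. -/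
theorem exists_pointed_homotopy_inverse [QuasiIso f] (c : C.X 0) (hc : (C.d 0 (-1)).hom c = 0)
    (hfc : (f.f 0).hom c ≠ 0) :
    ∃ (g : D ⟶ C) (h : ∀ i j, i + 1 = j → C.X i →ₗ[K] C.X j)
      (h' : ∀ i j, i + 1 = j → D.X i →ₗ[K] D.X j),
      (g.f 0).hom ((f.f 0).hom c) = c ∧ h 0 1 rfl c = 0 ∧ h' 0 1 rfl ((f.f 0).hom c) = 0 ∧
      (∀ i j k (hi : j + 1 = i) (hj : k + 1 = j) (x : C.X j), x - (g.f j).hom ((f.f j).hom x) =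
        (C.d i j).hom (h j i hi x) + h k j hj ((C.d j k).hom x)) ∧
      (∀ i j k (hi : j + 1 = i) (hj : k + 1 = j) (y : D.X j), y - (f.f j).hom ((g.f j).hom y) =
        (D.d i j).hom (h' j i hi y) + h' k j hj ((D.d j k).hom y)) := by
  -- Extending `c` by zero to all degrees lets the sections be chosen with one uniform prescribed
  -- value.
  let u : ∀ j, C.X j := Pi.single 0 c
  have hu0 : u 0 = c := Pi.single_eq_same _ _
  have hdu : ∀ j k, k + 1 = j → (C.d j k).hom (u j) = 0 := fun j k hk => by
    rcases eq_or_ne j 0 with rfl | hj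
    · obtain rfl : k = -1 := by omega
      rw [hu0, hc]
    · rw [show u j = 0 from Pi.single_eq_of_ne hj _, map_zero]
  have hinj : ∀ j, (f.f j).hom (u j) = 0 → u j = 0 := fun j h => by
    rcases eq_or_ne j 0 with rfl | hj
    · rw [hu0] at h
      exact absurd h hfc
    · exact Pi.single_eq_of_ne hj _
  have hcu : ∀ i j k, k + 1 = j → coneD f i j k (u j, 0) = (0, (f.f j).hom (u j)) :=
    fun i j k hk => by simp [coneD_apply, hdu j k hk]
  have hσ : ∀ i j k, j + 1 = i → k + 1 = j → ∃ σ : (C.X k × D.X j) →ₗ[K] (C.X j × D.X i),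
      (∀ p, coneD f j k (k - 1) p = 0 → coneD f i j k (σ p) = p) ∧
        σ (0, (f.f j).hom (u j)) = (u j, 0) := fun i j k hi hj => by
    obtain ⟨σ, h1, h2⟩ := exists_section_of_exact (coneD f i j k) (coneD f j k (k - 1))
      (coneD_coneD f i j k (k - 1)) (exists_coneD_eq f hi hj (by omega)) (u j, 0) (fun h => by
        rw [hcu i j k hj, Prod.mk_eq_zero] at h
        rw [hinj j h.2]
        rfl)
    rw [hcu i j k hj] at h2
    exact ⟨σ, h1, h2⟩
  choose σ hσ1 hσ2 using hσ
  -- With `∂` the cone differential, `S = σ (1 - σ ∂)`. Since `1 - σ ∂` lands in cycles, `∂ S = 1 -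
  -- σ ∂`, while `S ∂ = σ ∂`; so `S` contracts the cone.
  let S : ∀ i j k, j + 1 = i → k + 1 = j → (C.X k × D.X j) →ₗ[K] (C.X j × D.X i) :=
    fun i j k hi hj => σ i j k hi hj ∘ₗ
      (LinearMap.id - σ j k (k - 1) hj (by omega) ∘ₗ coneD f j k (k - 1))
  have hSdef : ∀ i j k hi hj p, S i j k hi hj p =
      σ i j k hi hj (p - σ j k (k - 1) hj (by omega) (coneD f j k (k - 1) p)) :=
    fun _ _ _ _ _ _ => rfl
  have hS : ∀ i j k l (hi : j + 1 = i) (hj : k + 1 = j) (hk : l + 1 = k) p,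
      coneD f i j k (S i j k hi hj p) + S j k l hj hk (coneD f j k l p) = p := by
    intro i j k l hi hj hk p
    obtain rfl : l = k - 1 := by omega
    rw [hSdef, hSdef, coneD_coneD, map_zero, sub_zero, hσ1, sub_add_cancel]
    rw [map_sub, hσ1 _ _ _ _ _ _ (coneD_coneD f _ _ _ _ _), sub_self]
  have hSv : ∀ i j k hi hj, S i j k hi hj (0, (f.f j).hom (u j)) = (u j, 0) := by
    intro i j k hi hj
    rw [hSdef, ← hcu i j k hj, coneD_coneD, map_zero, sub_zero, hcu i j k hj, hσ2]
  -- The prescribed value of `σ` at `∂ (u k, 0)` is `(u k, 0)`, so the factor `1 - σ ∂` kills this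
  -- vector.
  have hSu : ∀ i j k hi hj, S i j k hi hj (u k, 0) = 0 := by
    intro i j k hi hj
    rw [hSdef, hcu j k (k - 1) (by omega), hσ2, sub_self, map_zero]
  have hSr : ∀ i j k l (hi : j + 1 = i) (hj : k + 1 = j) (hk : l + 1 = k) (y : D.X j),
      (S j k l hj hk (0, (D.d j k).hom y)).1 = (C.d j k).hom (S i j k hi hj (0, y)).1 ∧
      y = (f.f j).hom (S i j k hi hj (0, y)).1 + (D.d i j).hom (S i j k hi hj (0, y)).2 +
        (S j k l hj hk (0, (D.d j k).hom y)).2 := by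
    intro i j k l hi hj hk y
    have h := hS i j k l hi hj hk (0, y)
    rw [coneD_apply f j k l, map_zero, map_zero, neg_zero, zero_add] at h
    constructor
    · have h1 : -(C.d j k).hom (S i j k hi hj (0, y)).1 +
          (S j k l hj hk (0, (D.d j k).hom y)).1 = 0 := congrArg Prod.fst h
      rwa [neg_add_eq_zero, eq_comm] at h1
    · exact (congrArg Prod.snd h).symm
  have hSl : ∀ i j k l (hi : j + 1 = i) (hj : k + 1 = j) (hk : l + 1 = k) (x : C.X k),
      x = -(C.d j k).hom (S i j k hi hj (x, 0)).1 - (S j k l hj hk ((C.d k l).hom x, 0)).1 +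
        (S j k l hj hk (0, (f.f k).hom x)).1 := by
    intro i j k l hi hj hk x
    have h := congrArg Prod.fst (hS i j k l hi hj hk (x, 0))
    have e : coneD f j k l (x, 0) = -((C.d k l).hom x, 0) + (0, (f.f k).hom x) := by
      simp [coneD_apply]
    rw [e, map_add, map_neg] at h
    refine h.symm.trans ?_
    rw [Prod.fst_add, Prod.fst_add, ← add_assoc, sub_eq_add_neg]
    rfl
  -- The matrix entries of `S` are the required data: the entry from `D` to `C` is the inverse,
  -- minus the entry from `C` to `C` and the entry from `D` to `D` are the homotopies.
  let g : D ⟶ C :=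
    { f := fun j => ModuleCat.ofHom (LinearMap.fst K _ _ ∘ₗ
        S (j + 1) j (j - 1) rfl (by omega) ∘ₗ LinearMap.inr K _ _)
      comm' := fun i j hij => by
        change j + 1 = i at hij
        subst hij
        ext y
        obtain ⟨h1, -⟩ := hSr (j + 1 + 1) (j + 1) j (j - 1) rfl rfl (by omega) y
        have hcast : ∀ k (hk : k + 1 = j + 1), (C.d (j + 1) j).hom
            (S (j + 1 + 1) (j + 1) k rfl hk (0, y)).1 =
            (C.d (j + 1) j).hom (S (j + 1 + 1) (j + 1) j rfl rfl (0, y)).1 := by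
          intro k hk
          obtain rfl : k = j := by omega
          rfl
        exact (hcast _ _).trans h1.symm }
  have hg : ∀ i j k (hi : j + 1 = i) (hj : k + 1 = j) y,
      (g.f j).hom y = (S i j k hi hj (0, y)).1 := by
    intro i j k hi hj y
    subst hi
    obtain rfl : k = j - 1 := by omega
    rfl
  refine ⟨g, fun i j hj => -(LinearMap.fst K _ _ ∘ₗ S (j + 1) j i rfl hj ∘ₗ LinearMap.inl K _ _),
    fun i j hj => LinearMap.snd K _ _ ∘ₗ S j i (i - 1) hj (by omega) ∘ₗ LinearMap.inr K _ _,
    ?_, ?_, ?_, ?_, ?_⟩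
  · have h := hSv 1 0 (-1) rfl rfl
    rw [hu0] at h
    rw [hg 1 0 (-1) rfl rfl, h]
  · have h := hSu 2 1 0 rfl rfl
    rw [hu0] at h
    exact neg_eq_zero.2 (congrArg Prod.fst h)
  · have h := hSv 1 0 (-1) rfl rfl
    rw [hu0] at h
    exact congrArg Prod.snd h
  · intro i j k hi hj x
    have h := hSl (i + 1) i j k rfl hi hj x
    rw [hg i j k hi hj]
    subst hi
    subst hj
    simp only [LinearMap.neg_apply, map_neg]
    rw [sub_eq_iff_eq_add]
    exact h.trans (by rw [sub_eq_add_neg]; rfl)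
  · intro i j k hi hj y
    obtain ⟨-, h⟩ := hSr i j k (k - 1) hi hj (by omega) y
    rw [hg i j k hi hj]
    have hcast : ∀ k' (hk' : k' + 1 = j), (S i j k' hi hk' (0, y)).2 = (S i j k hi hj (0, y)).2 := by
      intro k' hk'
      obtain rfl : k' = k := by omega
      rfl
    rw [sub_eq_iff_eq_add]
    refine h.trans ?_
    rw [← hcast (j - 1) (by omega)]
    rw [add_assoc, add_comm]
    rfl

end Contraction

/-! ### Conclusion: boundary units, zero brackets, and the general case -/

namespace ULieAlg

variable {K : Type u} [Field K] {V W : ULieAlg.{u, v} K}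

/-- If the unit of `V` is a boundary then the enveloping algebra is contractible. -/
theorem exists_homotopy_id_zero (x : V.X.X 1) (hx : (V.X.d 1 0).hom x = V.one) :
    Nonempty (Homotopy (𝟙 V.envComplex) 0) := by
  have hd : V.envD (V.gen 1 x) = 1 := by rw [V.envD_gen (i := 1) (i' := 0) rfl, hx, V.gen_one]
  -- Left multiplication by `x` is a contraction: by the Leibniz rule `d (x z) = z - x (d z)`.
  have H := envHomotopy (V := V) (W := V) LinearMap.id (fun _ _ h => h) (fun _ => rfl) 0
    (fun _ _ _ => zero_mem _) (fun _ => map_zero _) (LinearMap.mulLeft K (V.gen 1 x))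
    (fun n z hz => V.mul_mem_envDeg (add_comm 1 n) (V.gen_mem_envDeg 1 x) hz) (fun z => by
      rw [LinearMap.mulLeft_apply, LinearMap.mulLeft_apply, envD_gen_mul, hd, one_mul]
      simp)
  exact ⟨((Homotopy.ofEq (envChainMap_eq_id _ _ _ fun _ => rfl).symm).trans H).trans
    (Homotopy.ofEq rfl)⟩

/-- The image of `x` bounds the unit of `W`, so both enveloping algebras are contractible, and any
chain map between contractible complexes is a homotopy equivalence with inverse zero. -/
theorem quasiIso_envelopeMap_of_one_eq_d (f : V ⟶ W) (x : V.X.X 1)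
    (hx : (V.X.d 1 0).hom x = V.one) : QuasiIso (envelopeMap f).hom := by
  obtain ⟨H⟩ := exists_homotopy_id_zero x hx
  obtain ⟨H'⟩ := exists_homotopy_id_zero (V := W) ((f.hom.f 1).hom x) (by
    rw [hom_d_hom, hx, f.map_one])
  let E : HomotopyEquiv V.envComplex W.envComplex :=
    { hom := (envelopeMap f).hom
      inv := 0
      homotopyHomInvId := (Homotopy.ofEq Limits.comp_zero).trans H.symm
      homotopyInvHomId := (Homotopy.ofEq Limits.zero_comp).trans H'.symm }
  exact E.quasiIso_hom

section CharZero

variable [CharZero K]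

/-- A unital homotopy from the identity to a composite of unital chain maps induces a homotopy of
maps of enveloping algebras. -/
theorem exists_envelope_homotopy (f : V.ab ⟶ W.ab) (g : W.ab ⟶ V.ab)
    (h : ∀ i j, i + 1 = j → V.X.X i →ₗ[K] V.X.X j) (h1 : h 0 1 rfl V.one = 0)
    (hh : ∀ i j k (hi : j + 1 = i) (hj : k + 1 = j) (x : V.X.X j),
      x - (g.hom.f j).hom ((f.hom.f j).hom x) =
        (V.X.d i j).hom (h j i hi x) + h k j hj ((V.X.d j k).hom x)) :
    Nonempty (Homotopy ((envelopeMap f).hom ≫ (envelopeMap g).hom) (𝟙 V.ab.envComplex)) := by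
  have hcast : ∀ i j (hj : (i - 1) + 1 = j) y,
      V.ab.gen (i - 1 + 1) (h (i - 1) (i - 1 + 1) rfl y) = V.ab.gen j (h (i - 1) j hj y) := by
    intro i j hj y
    subst hj
    rfl
  obtain ⟨k, hk, hk'⟩ := exists_env_homotopy (V := V) (f ≫ g) (fun i => h i (i + 1) rfl) h1
    (fun i a => by
      rw [hcast i i (sub_add_cancel i 1), ← map_sub, ← map_add]
      exact congrArg (V.ab.gen i) (hh (i + 1) i (i - 1) rfl (sub_add_cancel i 1) a))
  have H := envHomotopy (V := V.ab) (W := V.ab) LinearMap.id (fun _ _ h => h) (fun _ => rfl)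
    (envMap (f ≫ g)).toLinearMap (fun _ _ hx => envMap_mem (f ≫ g) hx) (envMap_envD (f ≫ g)) k hk hk'
  have e : (envelopeMap (f ≫ g)).hom = (envelopeMap f).hom ≫ (envelopeMap g).hom :=
    congrArg AsAlg.Hom.hom ((phiShriek K).map_comp f g)
  exact ⟨(Homotopy.ofEq e.symm).trans (H.symm.trans
    (Homotopy.ofEq (envChainMap_eq_id _ _ _ fun _ => rfl)))⟩

/-- With zero brackets, every unit-preserving chain map is a morphism, so the pointed homotopy
inverse itself induces a map of enveloping algebras. Its existence needs `f` not to kill the unit.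
-/
theorem quasiIso_envelopeMap_ab (f : V ⟶ W) (hf : QuasiIso f.hom) (hW : W.one ≠ 0) :
    QuasiIso (envelopeMap (abHom f.hom f.map_one)).hom := by
  obtain ⟨g, h, h', hg, h1, h1', hh, hh'⟩ := exists_pointed_homotopy_inverse f.hom V.one V.d_one
    (by rwa [f.map_one])
  rw [f.map_one] at hg h1'
  obtain ⟨H⟩ := exists_envelope_homotopy (abHom f.hom f.map_one) (abHom g hg) h h1 hh
  obtain ⟨H'⟩ := exists_envelope_homotopy (abHom g hg) (abHom f.hom f.map_one) h' h1' hh'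
  let E : HomotopyEquiv V.ab.envComplex W.ab.envComplex :=
    { hom := (envelopeMap (abHom f.hom f.map_one)).hom
      inv := (envelopeMap (abHom g hg)).hom
      homotopyHomInvId := H
      homotopyInvHomId := H' }
  exact E.quasiIso_hom

variable (V) in
/-- The Poincaré-Birkhoff-Witt isomorphism as an isomorphism of complexes. -/
theorem exists_pbw_iso : ∃ (e : V.ab.Env →ₗ[K] V.Env) (hdeg : ∀ n, ∀ x ∈ V.ab.envDeg n,
    e x ∈ V.envDeg n) (he : ∀ l, e (V.ab.word l) = symFun K V.word l),
    IsIso (envChainMap e hdeg (envD_pbw he)) := by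
  obtain ⟨e, he, hdeg, hdeg'⟩ := V.exists_pbw
  have hd : ∀ x, V.ab.envD (e.symm x) = e.symm (V.envD x) := fun x => by
    rw [e.eq_symm_apply, ← LinearEquiv.coe_coe, ← envD_pbw he, LinearEquiv.coe_coe,
      e.apply_symm_apply]
  refine ⟨e, hdeg, he, envChainMap (V := V) (W := V.ab) e.symm.toLinearMap hdeg' hd, ?_, ?_⟩
  · rw [envChainMap_comp_eq _ _ _ _ _ _ LinearMap.id (fun _ _ h => h) (fun _ => rfl)
      e.symm_apply_apply]
    exact envChainMap_eq_id _ _ _ fun _ => rfl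
  · rw [envChainMap_comp_eq _ _ _ _ _ _ LinearMap.id (fun _ _ h => h) (fun _ => rfl)
      e.apply_symm_apply]
    exact envChainMap_eq_id _ _ _ fun _ => rfl

/-- The PBW isomorphisms form a commutative square with the two induced maps. -/
theorem quasiIso_envelopeMap_of_ab (f : V ⟶ W)
    (h : QuasiIso (envelopeMap (abHom f.hom f.map_one)).hom) : QuasiIso (envelopeMap f).hom := by
  obtain ⟨e, hdeg, he, hiso⟩ := V.exists_pbw_iso
  obtain ⟨e', hdeg', he', hiso'⟩ := W.exists_pbw_iso
  let F : V.envComplex ⟶ W.envComplex := (envelopeMap f).hom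
  let F' : V.ab.envComplex ⟶ W.ab.envComplex := (envelopeMap (abHom f.hom f.map_one)).hom
  have hF' : QuasiIso F' := h
  have hcomm : envChainMap e hdeg (envD_pbw he) ≫ F = F' ≫ envChainMap e' hdeg' (envD_pbw he') := by
    ext n x
    exact Subtype.ext (envMap_pbw he he' f x.1)
  have hcomp : QuasiIso (envChainMap e hdeg (envD_pbw he) ≫ F) := by
    rw [hcomm]
    infer_instance
  exact quasiIso_of_comp_left (envChainMap e hdeg (envD_pbw he)) F

end CharZero

end ULieAlg

theorem lemmaA1 (K : Type u) [Field K] [CharZero K] {V W : ULieAlg.{u, v} K} (f : V ⟶ W)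
    (hf : ULieAlg.weakEquivalences K f) :
    AsAlg.weakEquivalences K ((phiShriek K).map f) := by
  have hf' : QuasiIso f.hom := hf
  change QuasiIso (ULieAlg.envelopeMap f).hom
  -- If the unit of `W` vanishes, that of `V` is a cycle sent to zero, hence a boundary. No homotopy
  -- inverse could be pointed if the unit of `V` were nonzero, so this case is treated by
  -- contractibility.
  by_cases hW : W.one = 0
  · obtain ⟨x, hx⟩ := QuasiIso.exists_eq_d f.hom (i := 1) (j := 0) (k := -1) rfl rfl V.one V.d_one 0
      (by rw [f.map_one, hW, map_zero])
    exact ULieAlg.quasiIso_envelopeMap_of_one_eq_d f x hx.symm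
  · exact ULieAlg.quasiIso_envelopeMap_of_ab f (ULieAlg.quasiIso_envelopeMap_ab f hf' hW)
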